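/- Notation. For $f:\{0,1\}^n\to\{0,1\}$, all probabilities and expectations are over uniform $\boldsymbol{x}\in\{0,1\}^n$, and $\mathrm{Inf}_i(f)=\Pr[f(\boldsymbol{x})\ne f(\boldsymbol{x}^{\oplus i})]$, where $\boldsymbol{x}^{\oplus i}$ is $\boldsymbol{x}$ with its $i$-th coordinate flipped. The size of a decision tree is its number of leaves; a size-$s$ monotone decision tree is a decision tree with $s$ leaves that computes a monotone function (which we also denote by the same letter). A bare tree is a decision tree with unlabelled leaves; for a leaf $\ell$, $f_\ell$ is the restriction of $f$ by the path to $\ell$. The $f$-completion of a bare tree labels each leaf $\ell$ by the value that $f_\ell$ takes more often ($1$ if equally often). A function $g$ is an $\varepsilon$-approximation of $f$ if $\Pr[g(\boldsymbol{x})\neq f(\boldsymbol{x})]\le\varepsilon$. An impurity function is a concave $\mathscr{G}:[0,1]\to[0,1]$ with $\mathscr{G}(p)=\mathscr{G}(1-p)$, $\mathscr{G}(0)=\mathscr{G}(1)=0$ and $\mathscr{G}(\tfrac12)=1$ (for instance binary entropy in ID3 and C4.5, and $4p(1-p)$ in CART). Put $\mathcal{H}(T^\circ)=\sum_{\ell}\Pr[\boldsymbol{x}\text{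 reaches }\ell]\cdot\mathscr{G}(\mathbb{E}[f_\ell])$, the sum over the leaves of $T^\circ$, and let $T^\circ_{\ell,i}$ be $T^\circ$ with its leaf $\ell$ replaced by a query to $x_i$. The impurity-based top-down heuristic with impurity function $\mathscr{G}$, run on $f$ and $\varepsilon$, starts with the empty tree and, as long as the $f$-completion of the current bare tree $T^\circ$ is not an $\varepsilon$-approximation of $f$, replaces $T^\circ$ by $T^\circ_{\ell,i}$ for a leaf-variable pair $(\ell,i)$ that maximizes the purity gain $\mathcal{H}(T^\circ)-\mathcal{H}(T^\circ_{\ell,i})$ over all such pairs; when it stops, it outputs the $f$-completion. Ties are broken arbitrarily, except that if $\mathscr{G}$ is not strictly concave, then $x_i$ must be a most influential variable of $f_\ell$ among those with the same purity gain at $\ell$. Theorem. For every $\varepsilon\in(0,\tfrac12)$, every $C\in\mathbb{R}$ and every $a\in\mathbb{N}$ there are $c>0$ and $b\in\mathbb{N}$ such that for all $n\ge 0$ and $s\ge1$ with $$s\le 2^{C\,n^{4/5}\,(\ln(n+2))^{a}}$$ there is a size-$s$ monotone decision tree $f$ over $n$ variables such that, for every impurity function $\mathscr{G}$, every decision tree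 that can be output by the impurity-based top-down heuristic with impurity function $\mathscr{G}$ on $f$ and $\varepsilon$ has size at least $$s^{\,c\,(\log_2 s)^{1/4}/(\ln(\log_2 s+2))^{b}}.$$ That is, for every function $s(n)\le 2^{\tilde O(n^{4/5})}$ there is a size-$s$ monotone decision tree $f$ such that the $\varepsilon$-approximator built by any impurity-based top-down heuristic must have size $s^{\tilde\Omega(\sqrt[4]{\log s})}$. -/

import Mathlib

namespace TopDown

/-- Decision trees over the boolean variables `x_0, …, x_{n-1}` with leaves labelled in `α`.
`node i t₀ t₁` queries `x_i`, and continues in `t₀` if `x_i = 0` and in `t₁` if `x_i = 1`. -/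
inductive Tree (n : ℕ) (α : Type) : Type
  | leaf (a : α) : Tree n α
  | node (i : Fin n) (t₀ t₁ : Tree n α) : Tree n α

/-- A decision tree; the output values `false < true` stand for `-1 < +1` (or `0 < 1`). -/
abbrev DecisionTree (n : ℕ) : Type := Tree n Bool

/-- A decision tree with unlabelled leaves. -/
abbrev BareTree (n : ℕ) : Type := Tree n Unit

/-- A root-to-leaf path: the variables queried and the answers obtained, in order. -/
abbrev Path (n : ℕ) : Type := List (Fin n × Bool)

/-- The size of a tree is its number of leaves. -/
def Tree.size {n : ℕ} {α : Type} : Tree n α → ℕ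
  | .leaf _ => 1
  | .node _ t₀ t₁ => t₀.size + t₁.size

/-- The function computed by a tree. -/
def Tree.eval {n : ℕ} {α : Type} : Tree n α → (Fin n → Bool) → α
  | .leaf a, _ => a
  | .node i t₀ t₁, x => if x i = true then t₁.eval x else t₀.eval x

/-- The leaves of a tree, each given by the path that leads to it. -/
def Tree.leaves {n : ℕ} {α : Type} : Tree n α → List (Path n)
  | .leaf _ => [[]]
  | .node i t₀ t₁ =>
      t₀.leaves.map (fun p => (i, false) :: p) ++ t₁.leaves.map (fun p => (i, true) :: p)

/-- The bare tree obtained from a bare tree by replacing the leaf at the end of the path `p`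
with a query to the variable `x_i`. -/
def Tree.splitLeaf {n : ℕ} : BareTree n → Path n → Fin n → BareTree n
  | .leaf _, _, i => .node i (.leaf ()) (.leaf ())
  | .node j t₀ t₁, [], _ => .node j t₀ t₁
  | .node j t₀ t₁, (_, false) :: p, i => .node j (t₀.splitLeaf p i) t₁
  | .node j t₀ t₁, (_, true) :: p, i => .node j t₀ (t₁.splitLeaf p i)

/-- The probability of an event under the uniform distribution on `{0,1}ⁿ`. -/
noncomputable def prob {n : ℕ} (P : (Fin n → Bool) → Prop) [DecidablePred P] : ℝ :=
  ((Finset.univ.filter P).card : ℝ) / 2 ^ n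

/-- The mean of a `{0,1}`-valued function. -/
noncomputable def mean {n : ℕ} (f : (Fin n → Bool) → Bool) : ℝ :=
  prob (fun x => f x = true)

/-- `error(f, g) = Pr[f(x) ≠ g(x)]`. -/
noncomputable def error {n : ℕ} (f g : (Fin n → Bool) → Bool) : ℝ :=
  prob (fun x => f x ≠ g x)

/-- The influence of the variable `x_i` on `f`. -/
noncomputable def influence {n : ℕ} (f : (Fin n → Bool) → Bool) (i : Fin n) : ℝ :=
  prob (fun x => f x ≠ f (Function.update x i (!(x i))))

/-- The subfunction `f_{x_i = b}`. -/
def fix {n : ℕ} (f : (Fin n → Bool) → Bool) (i : Fin n) (b : Bool) : (Fin n → Bool) → Bool :=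
  fun x => f (Function.update x i b)

/-- The subfunction `f_ℓ` of `f`, the restriction of `f` by the path leading to `ℓ`. -/
def restrict {n : ℕ} (f : (Fin n → Bool) → Bool) : Path n → (Fin n → Bool) → Bool
  | [] => f
  | (i, b) :: p => restrict (fix f i b) p

/-- The probability that a uniformly random input reaches the leaf at the end of `p`. -/
noncomputable def reachProb {n : ℕ} (p : Path n) : ℝ :=
  prob (fun x : Fin n → Bool => ∀ e ∈ p, x e.1 = e.2)

open Classical in
/-- The `f`-completion of a bare tree: each leaf `ℓ` is labelled with the value that `f_ℓ`
takes more often (`true` if both values are equally frequent). -/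
noncomputable def completion {n : ℕ} (f : (Fin n → Bool) → Bool) : BareTree n → DecisionTree n
  | .leaf _ => .leaf (decide (1 / 2 ≤ mean f))
  | .node i t₀ t₁ => .node i (completion (fix f i false) t₀) (completion (fix f i true) t₁)

/-- The `f`-completion of `T` is an `ε`-approximation of `f`. -/
def Approximates {n : ℕ} (ε : ℝ) (T : BareTree n) (f : (Fin n → Bool) → Bool) : Prop :=
  error (completion f T).eval f ≤ ε

/-- Impurity functions `G : [0,1] → [0,1]`. -/
structure IsImpurity (G : ℝ → ℝ) : Prop where
  mapsTo : Set.MapsTo G (Set.Icc 0 1) (Set.Icc 0 1)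
  concave : ConcaveOn ℝ (Set.Icc 0 1) G
  symm : ∀ p ∈ Set.Icc (0 : ℝ) 1, G (1 - p) = G p
  zero : G 0 = 0
  one : G 1 = 0
  half : G (1 / 2) = 1

/-- The progress measure `H(T) = ∑_ℓ Pr[x reaches ℓ] · G(E[f_ℓ])`. -/
noncomputable def progress {n : ℕ} (G : ℝ → ℝ) (f : (Fin n → Bool) → Bool) (T : BareTree n) : ℝ :=
  (T.leaves.map (fun p => reachProb p * G (mean (restrict f p)))).sum

/-- The purity gain `H(T) - H(T_{ℓ,i})`. -/
noncomputable def purityGain {n : ℕ} (G : ℝ → ℝ) (f : (Fin n → Bool) → Bool) (T : BareTree n)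
    (p : Path n) (i : Fin n) : ℝ :=
  progress G f T - progress G f (T.splitLeaf p i)

/-- `(ℓ, i)` may be chosen for the next split: it maximizes the purity gain over all leaf-variable
pairs. Ties are broken arbitrarily if `G` is strictly concave. If `G` is concave but not strictly
so, variables of very different influence can have equal purity gain at `ℓ`; then a most
influential one of those with the maximal gain is queried. -/
def IsGreedySplit {n : ℕ} (G : ℝ → ℝ) (f : (Fin n → Bool) → Bool) (T : BareTree n)
    (p : Path n) (i : Fin n) : Prop :=
  p ∈ T.leaves ∧
  (∀ q ∈ T.leaves, ∀ j : Fin n, purityGain G f T q j ≤ purityGain G f T p i) ∧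
  (StrictConcaveOn ℝ (Set.Icc 0 1) G ∨
    ∀ j : Fin n, purityGain G f T p j = purityGain G f T p i →
      influence (restrict f p) j ≤ influence (restrict f p) i)

/-- The bare trees that occur in a run of the impurity-based top-down heuristic with impurity
function `G` on `f` and `ε`: start from the empty tree and, while the `f`-completion of the
current tree is not an `ε`-approximation of `f`, perform a greedy split. -/
inductive Grown {n : ℕ} (G : ℝ → ℝ) (f : (Fin n → Bool) → Bool) (ε : ℝ) : BareTree n → Prop
  | start : Grown G f ε (.leaf ())
  | grow (T : BareTree n) (p : Path n) (i : Fin n) :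
      Grown G f ε T → ¬ Approximates ε T f → IsGreedySplit G f T p i →
      Grown G f ε (T.splitLeaf p i)

/-- `A` is a possible output of the impurity-based top-down heuristic with impurity function `G`
on `f` and `ε`: the `f`-completion of the tree at which a run stops. -/
def IsOutput {n : ℕ} (G : ℝ → ℝ) (f : (Fin n → Bool) → Bool) (ε : ℝ) (A : DecisionTree n) : Prop :=
  ∃ T : BareTree n, Grown G f ε T ∧ Approximates ε T f ∧ A = completion f T

end TopDown

/-! For monotone `f`, splitting on `x_i` produces children of means `E[f] ± Inf_i/2`, so concavity
makes the purity gain nondecreasing in the influence. With the tie rule, every query of the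
heuristic goes to a most influential variable of the current subfunction
(`Grown.queriesMaxInfluence`). It remains to find a monotone function with a small tree on which
such queries are wasteful.

Let `y = 2^v`. The hard function has `y` blocks of `y^4` variables and disjoint tribes (ANDs) of
width `4v`, each satisfied with probability `y^{-4}`. Uncoloured tribes, at most `y^4` of them,
force the value 1 and are all unsatisfied with probability about 1/2; each block moreover has `256
y^2` tribes of its colour. A single active colour hands the value over to the majority of its block,
two active colours give 1. A tree that reads the tribes first needs at most one block afterwards, so
its size is `2^{O(v y^4)}`.

A tribe variable has influence at most `2 y^{-4}`. A block variable is pivotal when its colour alone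
is active (probability of order `y^{-2}`) and the rest of its block is tied (order `y^{-2}`); the
constant 256 makes this exceed `2 y^{-4}`. The bound survives while the block has few variables set
and these are fairly balanced (`block_of_isMax_influence`), so the heuristic reads block variables
until every block is spoilt. Yet blocks hardly matter: some coloured tribe is satisfied with
probability only `O(1/y)`, and with any block variables set the mean stays near 1/2. A leaf that has
seen only blocks thus errs with probability near 1/2.

How long this lasts is a martingale question. The sum over blocks of the squared imbalance grows by
exactly one in expectation per block query, but must reach order `y^5` before all blocks are spoilt
within a small constant times `y^5` queries. So a constant fraction of random paths makes order
`y^5` queries (`one_le_of_queriesMaxInfluence`, `size_ge_of_queriesMaxInfluence`), and the output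
has size `2^{Ω(y^5)}`. As `log s` is about `y^4` and `n` about `y^5`, up to logarithms, the exponent
`y^5 = y^4 · y` yields the fourth root, and `n^{4/5}` is the range of `log s`. -/

namespace TopDown

/-! ### Averages over the cube and independence -/

/-- The average of a real function over the uniform distribution on `{0,1}ⁿ`. -/
noncomputable def avg {n : ℕ} (g : (Fin n → Bool) → ℝ) : ℝ := (∑ x, g x) / 2 ^ n

open Classical in
/-- The indicator of a proposition. -/
noncomputable def ind (P : Prop) : ℝ := if P then 1 else 0

theorem ind_true {P : Prop} (h : P) : ind P = 1 := if_pos h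

theorem ind_false {P : Prop} (h : ¬ P) : ind P = 0 := if_neg h

theorem ind_nonneg (P : Prop) : 0 ≤ ind P := by
  by_cases h : P
  · rw [ind_true h]; norm_num
  · rw [ind_false h]

theorem ind_mono {P Q : Prop} (h : P → Q) : ind P ≤ ind Q := by
  by_cases hP : P
  · rw [ind_true hP, ind_true (h hP)]
  · rw [ind_false hP]; exact ind_nonneg Q

theorem ind_and (P Q : Prop) : ind (P ∧ Q) = ind P * ind Q := by
  by_cases hP : P <;> by_cases hQ : Q <;> simp [ind, hP, hQ]

theorem ind_not (P : Prop) : ind (¬ P) = 1 - ind P := by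
  by_cases hP : P <;> simp [ind, hP]

section avg

variable {n : ℕ}

theorem prob_eq_avg (P : (Fin n → Bool) → Prop) [DecidablePred P] :
    prob P = avg (fun x => ind (P x)) := by
  unfold prob avg
  congr 1
  rw [Finset.card_filter]
  push_cast
  refine Finset.sum_congr rfl fun x _ => ?_
  by_cases h : P x <;> simp [ind, h]

theorem avg_mono {g h : (Fin n → Bool) → ℝ} (H : ∀ x, g x ≤ h x) : avg g ≤ avg h := by
  unfold avg
  gcongr
  exact H _

theorem avg_const (c : ℝ) : avg (fun _ : Fin n → Bool => c) = c := by
  simp [avg]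

theorem avg_add (g h : (Fin n → Bool) → ℝ) : avg (fun x => g x + h x) = avg g + avg h := by
  simp [avg, Finset.sum_add_distrib, add_div]

theorem avg_sub (g h : (Fin n → Bool) → ℝ) : avg (fun x => g x - h x) = avg g - avg h := by
  simp [avg, Finset.sum_sub_distrib, sub_div]

theorem avg_mul_left (c : ℝ) (g : (Fin n → Bool) → ℝ) :
    avg (fun x => c * g x) = c * avg g := by
  simp [avg, ← Finset.mul_sum, mul_div_assoc]

theorem avg_nonneg {g : (Fin n → Bool) → ℝ} (H : ∀ x, 0 ≤ g x) : 0 ≤ avg g := by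
  rw [← avg_const (n := n) 0]
  exact avg_mono H

/-- The involution of the cube that flips the `i`-th coordinate. -/
def flipEquiv (i : Fin n) : Equiv.Perm (Fin n → Bool) where
  toFun x := Function.update x i (!(x i))
  invFun x := Function.update x i (!(x i))
  left_inv x := by simp
  right_inv x := by simp

theorem avg_flip (i : Fin n) (g : (Fin n → Bool) → ℝ) :
    avg (fun x => g (Function.update x i (!(x i)))) = avg g := by
  unfold avg
  congr 1
  exact Equiv.sum_comp (flipEquiv i) g

theorem avg_cond (i : Fin n) (g : (Fin n → Bool) → ℝ) :
    avg g = (avg (fun x => g (Function.update x i false)) +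
      avg (fun x => g (Function.update x i true))) / 2 := by
  rw [← avg_add]
  have : (fun x => g (Function.update x i false) + g (Function.update x i true)) =
      fun x => g x + g (Function.update x i (!(x i))) := by
    funext x
    have hx : Function.update x i (x i) = x := Function.update_eq_self i x
    cases h : x i
    · rw [h] at hx; simp [hx]
    · rw [h] at hx; simp [hx]; ring
  rw [this, avg_add, avg_flip]
  ring

theorem DependsOn.comp_update {β : Type*} {g : (Fin n → Bool) → β} {s : Set (Fin n)} {i : Fin n}
    (hg : DependsOn g (insert i s)) (b : Bool) :
    DependsOn (fun x => g (Function.update x i b)) s := by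
  intro x y h
  apply hg
  intro j hj
  by_cases hji : j = i
  · subst hji; simp
  · simp only [Function.update_of_ne hji]
    exact h j (hj.resolve_left hji)

/-- Independence of functions of disjoint sets of coordinates: conditioning on one coordinate of `A`
leaves `h` unchanged and removes that coordinate from `g`. -/
theorem avg_mul_of_dependsOn (A : Finset (Fin n)) :
    ∀ g h : (Fin n → Bool) → ℝ, DependsOn g (A : Set (Fin n)) → DependsOn h ((A : Set (Fin n))ᶜ) →
      avg (fun x => g x * h x) = avg g * avg h := by
  induction A using Finset.induction_on with
  | empty =>
    intro g h hg _
    have : ∀ x, g x = g (fun _ => false) := fun x => hg (by simp)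
    have h1 : g = fun _ => g (fun _ => false) := funext this
    rw [h1, avg_mul_left, avg_const]
  | insert i A hi ih =>
    intro g h hg hh
    rw [Finset.coe_insert] at hg hh
    have hh' : ∀ x b, h (Function.update x i b) = h x := by
      intro x b
      apply hh
      intro j hj
      have : j ≠ i := fun e => hj (by simp [e])
      simp [this]
    have hA : DependsOn h ((A : Set (Fin n))ᶜ) := by
      intro x y hxy
      apply hh
      intro j hj
      exact hxy j fun hjA => hj (Or.inr hjA)
    rw [avg_cond i, avg_cond i g]
    simp only [hh']
    rw [ih _ h (DependsOn.comp_update hg false) hA, ih _ h (DependsOn.comp_update hg true) hA]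
    ring

theorem avg_mul_of_disjoint {A B : Finset (Fin n)} (hAB : Disjoint A B)
    {g h : (Fin n → Bool) → ℝ} (hg : DependsOn g (A : Set (Fin n)))
    (hh : DependsOn h (B : Set (Fin n))) :
    avg (fun x => g x * h x) = avg g * avg h := by
  refine avg_mul_of_dependsOn A g h hg fun x y hxy => hh fun i hi => hxy i fun hA => ?_
  exact Finset.disjoint_left.mp hAB hA hi

theorem avg_forall_true (A : Finset (Fin n)) :
    avg (fun x => ind (∀ i ∈ A, x i = true)) = (1 / 2) ^ A.card := by
  induction A using Finset.induction_on with
  | empty => simp [ind, avg_const]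
  | insert i A hi ih =>
    rw [avg_cond i]
    have h0 : ∀ x : Fin n → Bool,
        ind (∀ j ∈ insert i A, Function.update x i false j = true) = 0 := fun x =>
      ind_false fun H => by simpa using H i (by simp)
    have h1 : ∀ x : Fin n → Bool,
        ind (∀ j ∈ insert i A, Function.update x i true j = true) =
          ind (∀ j ∈ A, x j = true) := fun x => by
      congr 1
      apply propext
      constructor
      · intro H j hj
        have hji : j ≠ i := fun e => hi (e ▸ hj)
        simpa [hji] using H j (by simp [hj])
      · intro H j hj
        by_cases hji : j = i
        · subst hji; simp
        · simpa [hji] using H j ((Finset.mem_insert.mp hj).resolve_left hji)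
    simp only [h0, h1, avg_const, ih, Finset.card_insert_of_notMem hi]
    ring

theorem filter_update_card {A : Finset (Fin n)} {i : Fin n} (hi : i ∉ A) (x : Fin n → Bool)
    (b : Bool) :
    ((insert i A).filter fun j => Function.update x i b j = true).card =
      b.toNat + (A.filter fun j => x j = true).card := by
  have h : (A.filter fun j => Function.update x i b j = true) = A.filter fun j => x j = true := by
    refine Finset.filter_congr fun j hj => ?_
    have hji : j ≠ i := fun e => hi (e ▸ hj)
    simp [hji]
  rw [Finset.filter_insert, h]
  cases b
  · simp
  · simp [hi, add_comm]

/-- The binomial distribution; conditioning on one coordinate is Pascal's rule. -/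
theorem avg_card_eq (A : Finset (Fin n)) (c : ℕ) :
    avg (fun x => ind ((A.filter fun i => x i = true).card = c)) =
      (A.card.choose c : ℝ) / 2 ^ A.card := by
  induction A using Finset.induction_on generalizing c with
  | empty =>
    cases c <;> simp [ind, avg_const]
  | insert i A hi ih =>
    rw [avg_cond i]
    simp only [filter_update_card hi, Finset.card_insert_of_notMem hi, Bool.toNat_true,
      Bool.toNat_false, zero_add]
    cases c with
    | zero =>
      have h1 : ∀ x : Fin n → Bool,
          ind (1 + (A.filter fun j => x j = true).card = 0) = 0 :=
        fun x => ind_false (by simp)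
      rw [show (fun x : Fin n → Bool =>
        ind (1 + (A.filter fun j => x j = true).card = 0)) =
        fun _ => 0 from funext h1, avg_const]
      have := ih 0
      simp only [this]
      simp [pow_succ]
      ring
    | succ c =>
      have h1 : ∀ x : Fin n → Bool,
          (1 + (A.filter fun j => x j = true).card = c + 1) =
            ((A.filter fun j => x j = true).card = c) :=
        fun x => by simp; omega
      rw [show (fun x : Fin n → Bool =>
        ind (1 + (A.filter fun j => x j = true).card = c + 1)) =
        fun x => ind ((A.filter fun j => x j = true).card = c) from
          funext fun x => congrArg ind (h1 x)]
      simp only [ih, Nat.choose_succ_succ]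
      push_cast
      rw [pow_succ]
      field_simp
      ring

end avg

/-! ### Means and influences of monotone functions -/

section monotone

variable {n : ℕ} {g : (Fin n → Bool) → Bool}

theorem monotone_update (i : Fin n) (b : Bool) :
    Monotone fun x : Fin n → Bool => Function.update x i b := by
  intro x y h j
  by_cases hj : j = i
  · subst hj; simp
  · simpa [hj] using h j

theorem monotone_fix (hg : Monotone g) (i : Fin n) (b : Bool) : Monotone (fix g i b) :=
  hg.comp (monotone_update i b)

theorem monotone_restrict (hg : Monotone g) (p : Path n) : Monotone (restrict g p) := by
  induction p generalizing g with
  | nil => exact hg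
  | cons e p ih => exact ih (monotone_fix hg e.1 e.2)

theorem mean_eq_avg (g : (Fin n → Bool) → Bool) : mean g = avg fun x => ind (g x = true) :=
  prob_eq_avg _

theorem mean_cond (g : (Fin n → Bool) → Bool) (i : Fin n) :
    mean g = (mean (fix g i false) + mean (fix g i true)) / 2 := by
  simp only [mean_eq_avg, fix]
  exact avg_cond i _

theorem mean_mem_Icc (g : (Fin n → Bool) → Bool) : mean g ∈ Set.Icc (0 : ℝ) 1 := by
  rw [mean_eq_avg]
  refine ⟨avg_nonneg fun x => ind_nonneg _, ?_⟩
  rw [← avg_const (n := n) 1]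
  refine avg_mono fun x => ?_
  rw [← ind_true trivial]
  exact ind_mono fun _ => trivial

theorem influence_eq_avg (g : (Fin n → Bool) → Bool) (i : Fin n) :
    influence g i = avg fun x => ind (g x ≠ g (Function.update x i (!(x i)))) :=
  prob_eq_avg _

theorem influence_nonneg (g : (Fin n → Bool) → Bool) (i : Fin n) : 0 ≤ influence g i := by
  rw [influence_eq_avg]
  exact avg_nonneg fun x => ind_nonneg _

theorem influence_eq_zero_iff (g : (Fin n → Bool) → Bool) (i : Fin n) :
    influence g i = 0 ↔ ∀ x, g x = g (Function.update x i (!(x i))) := by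
  unfold influence prob
  rw [div_eq_zero_iff]
  simp [Finset.filter_eq_empty_iff]

/-- By monotonicity, raising `x_i` can change the value only from 0 to 1, so the indicator of a
change is the difference of the two restrictions. -/
theorem influence_eq_mean_sub (hg : Monotone g) (i : Fin n) :
    influence g i = mean (fix g i true) - mean (fix g i false) := by
  rw [influence_eq_avg, avg_cond i, mean_eq_avg, mean_eq_avg, ← avg_sub]
  have h : ∀ x : Fin n → Bool, (fix g i false x = true → fix g i true x = true) := by
    intro x hx
    have : fix g i false x ≤ fix g i true x := hg (by
      intro j
      by_cases hj : j = i
      · subst hj; simp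
      · simp [hj])
    rw [hx] at this
    exact Bool.eq_true_of_true_le this
  have e : ∀ x, ind (fix g i true x = true) - ind (fix g i false x = true) =
      ind (fix g i false x ≠ fix g i true x) := by
    intro x
    have := h x
    cases h0 : fix g i false x <;> cases h1 : fix g i true x <;> simp_all [ind]
  have e' : ∀ x, ind (fix g i false x ≠ fix g i true x) =
      ind (fix g i true x ≠ fix g i false x) := fun x => by rw [ne_comm]
  simp only [e, Function.update_self, Function.update_idem, Bool.not_false, Bool.not_true]
  change (avg (fun x => ind (fix g i false x ≠ fix g i true x)) +
    avg (fun x => ind (fix g i true x ≠ fix g i false x))) / 2 = _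
  simp only [← e']
  ring

end monotone

/-! ### From purity gain to influence -/

section gain

/-- The spread lemma: the average of a concave function at `m - δ` and `m + δ` decreases in `δ`. -/
theorem concave_spread {G : ℝ → ℝ} (hG : ConcaveOn ℝ (Set.Icc 0 1) G) {m d e : ℝ}
    (hd : 0 ≤ d) (hde : d < e) (h0 : 0 ≤ m - e) (h1 : m + e ≤ 1) :
    G (m - e) + G (m + e) ≤ G (m - d) + G (m + d) := by
  have he : 0 < e := hd.trans_lt hde
  have hA : m - e ∈ Set.Icc (0 : ℝ) 1 := ⟨h0, by linarith⟩
  have hB : m + e ∈ Set.Icc (0 : ℝ) 1 := ⟨by linarith, h1⟩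
  have hr : d / e ≤ 1 := (div_le_one he).mpr hde.le
  have hr0 : 0 ≤ d / e := by positivity
  have hc : d / e * e = d := div_mul_cancel₀ d he.ne'
  have hG' := hG.2
  -- The inner points `m - d` and `m + d` are convex combinations of `m - e` and `m + e` with
  -- weights `(1 ± d/e)/2`; adding the two concavity inequalities cancels the weights.
  have k1 := hG' hA hB (a := (1 + d / e) / 2) (b := (1 - d / e) / 2) (by linarith) (by linarith)
    (by ring)
  have k2 := hG' hA hB (a := (1 - d / e) / 2) (b := (1 + d / e) / 2) (by linarith) (by linarith)
    (by ring)
  simp only [smul_eq_mul] at k1 k2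
  rw [show (1 + d / e) / 2 * (m - e) + (1 - d / e) / 2 * (m + e) = m - d by
    linear_combination -hc] at k1
  rw [show (1 - d / e) / 2 * (m - e) + (1 + d / e) / 2 * (m + e) = m + d by
    linear_combination hc] at k2
  linarith

theorem strictConcave_spread {G : ℝ → ℝ} (hG : StrictConcaveOn ℝ (Set.Icc 0 1) G) {m d e : ℝ}
    (hd : 0 ≤ d) (hde : d < e) (h0 : 0 ≤ m - e) (h1 : m + e ≤ 1) :
    G (m - e) + G (m + e) < G (m - d) + G (m + d) := by
  have he : 0 < e := hd.trans_lt hde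
  have hA : m - e ∈ Set.Icc (0 : ℝ) 1 := ⟨h0, by linarith⟩
  have hB : m + e ∈ Set.Icc (0 : ℝ) 1 := ⟨by linarith, h1⟩
  have hr : d / e < 1 := (div_lt_one he).mpr hde
  have hr0 : 0 ≤ d / e := by positivity
  have hc : d / e * e = d := div_mul_cancel₀ d he.ne'
  have hne : m - e ≠ m + e := by intro h; linarith
  have hG' := hG.2
  have k1 := hG' hA hB hne (a := (1 + d / e) / 2) (b := (1 - d / e) / 2) (by linarith)
    (by linarith) (by ring)
  have k2 := hG' hA hB hne (a := (1 - d / e) / 2) (b := (1 + d / e) / 2) (by linarith)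
    (by linarith) (by ring)
  simp only [smul_eq_mul] at k1 k2
  rw [show (1 + d / e) / 2 * (m - e) + (1 - d / e) / 2 * (m + e) = m - d by
    linear_combination -hc] at k1
  rw [show (1 - d / e) / 2 * (m - e) + (1 + d / e) / 2 * (m + e) = m + d by
    linear_combination hc] at k2
  linarith

variable {n : ℕ}

theorem sum_leaves_splitLeaf (T : BareTree n) (F : Path n → ℝ) (p : Path n) (i : Fin n)
    (hp : p ∈ T.leaves) :
    ((T.splitLeaf p i).leaves.map F).sum =
      (T.leaves.map F).sum - F p + (F (p ++ [(i, false)]) + F (p ++ [(i, true)])) := by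
  induction T generalizing F p with
  | leaf a =>
    simp only [Tree.leaves, List.mem_singleton] at hp
    subst hp
    simp [Tree.splitLeaf, Tree.leaves]
  | node j t₀ t₁ ih₀ ih₁ =>
    simp only [Tree.leaves, List.mem_append, List.mem_map] at hp
    rcases hp with ⟨q, hq, rfl⟩ | ⟨q, hq, rfl⟩
    · have := ih₀ (fun p => F ((j, false) :: p)) q hq
      simp only [Tree.splitLeaf, Tree.leaves, List.map_append, List.sum_append, List.map_map,
        Function.comp_def, this, List.cons_append]
      ring
    · have := ih₁ (fun p => F ((j, true) :: p)) q hq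
      simp only [Tree.splitLeaf, Tree.leaves, List.map_append, List.sum_append, List.map_map,
        Function.comp_def, this, List.cons_append]
      ring

theorem mem_leaves_splitLeaf {T : BareTree n} {p q : Path n} {i : Fin n} (hp : p ∈ T.leaves)
    (hq : q ∈ (T.splitLeaf p i).leaves) : q ∈ T.leaves ∨ ∃ b, q = p ++ [(i, b)] := by
  induction T generalizing p q with
  | leaf a =>
    simp only [Tree.leaves, List.mem_singleton] at hp
    subst hp
    simp only [Tree.splitLeaf, Tree.leaves, List.mem_append, List.mem_map, List.mem_singleton] at hq
    rcases hq with ⟨_, rfl, rfl⟩ | ⟨_, rfl, rfl⟩ <;> simp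
  | node j t₀ t₁ ih₀ ih₁ =>
    simp only [Tree.leaves, List.mem_append, List.mem_map] at hp
    rcases hp with ⟨p', hp', rfl⟩ | ⟨p', hp', rfl⟩ <;>
      simp only [Tree.splitLeaf, Tree.leaves, List.mem_append, List.mem_map] at hq
    · rcases hq with ⟨q', hq', rfl⟩ | ⟨q', hq', rfl⟩
      · rcases ih₀ hp' hq' with h | ⟨b, rfl⟩
        · left; simp [Tree.leaves, h]
        · right; exact ⟨b, rfl⟩
      · left; simp [Tree.leaves, hq']
    · rcases hq with ⟨q', hq', rfl⟩ | ⟨q', hq', rfl⟩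
      · left; simp [Tree.leaves, hq']
      · rcases ih₁ hp' hq' with h | ⟨b, rfl⟩
        · left; simp [Tree.leaves, h]
        · right; exact ⟨b, rfl⟩

theorem restrict_append (f : (Fin n → Bool) → Bool) (p q : Path n) :
    restrict f (p ++ q) = restrict (restrict f p) q := by
  induction p generalizing f with
  | nil => rfl
  | cons e p ih => exact ih _

theorem fix_eq_self_iff (g : (Fin n → Bool) → Bool) (i : Fin n) :
    influence g i = 0 ↔ ∀ b, fix g i b = g := by
  rw [influence_eq_zero_iff]
  constructor
  · intro h b
    funext x
    by_cases hb : x i = b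
    · simp [fix, ← hb]
    · have : b = !(x i) := by cases h : x i <;> cases b <;> simp_all
      rw [h x, fix, this]
  · intro h x
    exact (congrFun (h (!(x i))) x).symm

theorem fix_comm (g : (Fin n → Bool) → Bool) {i j : Fin n} (hij : i ≠ j) (b c : Bool) :
    fix (fix g i b) j c = fix (fix g j c) i b := by
  funext x
  simp only [fix, Function.update_comm hij]

theorem fix_fix (g : (Fin n → Bool) → Bool) (i : Fin n) (b c : Bool) :
    fix (fix g i b) i c = fix g i b := by
  funext x
  simp [fix]

theorem influence_fix_eq_zero {g : (Fin n → Bool) → Bool} {j : Fin n} (h : influence g j = 0)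
    (i : Fin n) (b : Bool) : influence (fix g i b) j = 0 := by
  rw [fix_eq_self_iff] at h ⊢
  intro c
  by_cases hij : i = j
  · subst hij; exact fix_fix g i b c
  · rw [fix_comm g hij, h c]

/-- The heuristic is not forbidden to repeat a query; this makes repeated variables harmless. -/
theorem influence_restrict_eq_zero {f : (Fin n → Bool) → Bool} {i : Fin n} {p : Path n}
    (hi : i ∈ p.map Prod.fst) : influence (restrict f p) i = 0 := by
  have key : ∀ (p : Path n) (f : (Fin n → Bool) → Bool), influence f i = 0 →
      influence (restrict f p) i = 0 := by
    intro p
    induction p with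
    | nil => exact fun f hf => hf
    | cons e p ih => exact fun f hf => ih _ (influence_fix_eq_zero hf e.1 e.2)
  induction p generalizing f with
  | nil => simp at hi
  | cons e p ih =>
    by_cases h : i = e.1
    · refine key p _ ?_
      rw [fix_eq_self_iff]
      intro c
      rw [h, fix_fix]
    · refine ih ?_
      simpa [h] using hi

theorem reachProb_eq_avg (p : Path n) :
    reachProb p = avg fun x : Fin n → Bool => ind (∀ e ∈ p, x e.1 = e.2) :=
  prob_eq_avg _

theorem reachProb_nonneg (p : Path n) : 0 ≤ reachProb p := by
  rw [reachProb_eq_avg]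
  exact avg_nonneg fun _ => ind_nonneg _

theorem reachProb_snoc_add (p : Path n) (i : Fin n) :
    reachProb (p ++ [(i, false)]) + reachProb (p ++ [(i, true)]) = reachProb p := by
  simp only [reachProb_eq_avg, ← avg_add]
  congr 1
  funext x
  have : ∀ b, ind (∀ e ∈ p ++ [(i, b)], x e.1 = e.2) =
      ind (∀ e ∈ p, x e.1 = e.2) * ind (x i = b) := by
    intro b
    rw [← ind_and]
    congr 1
    apply propext
    simp only [List.mem_append, List.mem_singleton]
    constructor
    · exact fun H => ⟨fun e he => H e (Or.inl he), H (i, b) (Or.inr rfl)⟩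
    · rintro ⟨H1, H2⟩ e (he | rfl)
      · exact H1 e he
      · exact H2
  rw [this, this]
  cases x i <;> simp [ind]

theorem reachProb_snoc {p : Path n} {i : Fin n} (hi : i ∉ p.map Prod.fst) (b : Bool) :
    reachProb (p ++ [(i, b)]) = reachProb p / 2 := by
  have key : reachProb (p ++ [(i, false)]) = reachProb (p ++ [(i, true)]) := by
    rw [reachProb_eq_avg, reachProb_eq_avg, ← avg_flip i]
    congr 1
    funext x
    congr 1
    apply propext
    have : ∀ e ∈ p, Function.update x i (!(x i)) e.1 = x e.1 := fun e he => by
      have : e.1 ≠ i := fun h => hi (h ▸ List.mem_map_of_mem he)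
      simp [this]
    simp only [List.mem_append, List.mem_singleton]
    constructor
    · rintro H e (he | rfl)
      · rw [← this e he]; exact H e (Or.inl he)
      · simpa using H (i, false) (Or.inr rfl)
    · rintro H e (he | rfl)
      · rw [this e he]; exact H e (Or.inl he)
      · simpa using H (i, true) (Or.inr rfl)
  have := reachProb_snoc_add p i
  cases b <;> linarith

theorem purityGain_eq (G : ℝ → ℝ) (f : (Fin n → Bool) → Bool) {T : BareTree n} {p : Path n}
    (hp : p ∈ T.leaves) (i : Fin n) :
    purityGain G f T p i = reachProb p * (G (mean (restrict f p)) -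
      (G (mean (fix (restrict f p) i false)) + G (mean (fix (restrict f p) i true))) / 2) := by
  unfold purityGain progress
  rw [sum_leaves_splitLeaf T _ p i hp, restrict_append, restrict_append]
  change _ - (_ - _ + (reachProb _ * G (mean (fix (restrict f p) i false)) +
    reachProb _ * G (mean (fix (restrict f p) i true)))) = _
  -- On a repeated query the two new leaves need not be equally likely, but both restrictions equal
  -- the old one and the two probabilities still add up, so both sides vanish.
  by_cases hi : i ∈ p.map Prod.fst
  · have h := (fix_eq_self_iff (restrict f p) i).mp (influence_restrict_eq_zero hi)
    rw [h, h]
    linear_combination (-G (mean (restrict f p))) * reachProb_snoc_add p i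
  · rw [reachProb_snoc hi, reachProb_snoc hi]
    ring

/-- The children have means `mean g ± influence/2`, so a more influential variable spreads them
further and gains at least as much: strictly more if `G` is strictly concave, and otherwise a tie is
settled by the rule in favour of influence. Positive reach probability is needed to cancel that
factor from the gains. -/
theorem influence_le_of_isGreedySplit {G : ℝ → ℝ} (hG : IsImpurity G)
    {f : (Fin n → Bool) → Bool} (hf : Monotone f) {T : BareTree n} {p : Path n} {i : Fin n}
    (h : IsGreedySplit G f T p i) (hp : 0 < reachProb p) (j : Fin n) :
    influence (restrict f p) j ≤ influence (restrict f p) i := by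
  obtain ⟨hpT, hmax, htie⟩ := h
  by_contra! hlt
  have hle := hmax p hpT j
  have hmono := monotone_restrict hf p
  set g := restrict f p with hg
  have hi := influence_eq_mean_sub hmono i
  have hj := influence_eq_mean_sub hmono j
  have mi := mean_cond g i
  have mj := mean_cond g j
  have e1 : mean (fix g i false) = mean g - influence g i / 2 := by linarith
  have e2 : mean (fix g i true) = mean g + influence g i / 2 := by linarith
  have e3 : mean (fix g j false) = mean g - influence g j / 2 := by linarith
  have e4 : mean (fix g j true) = mean g + influence g j / 2 := by linarith
  have h0 : 0 ≤ influence g i / 2 := by linarith [influence_nonneg g i]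
  have hlt' : influence g i / 2 < influence g j / 2 := by linarith
  have b0 : 0 ≤ mean g - influence g j / 2 := e3 ▸ (mean_mem_Icc _).1
  have b1 : mean g + influence g j / 2 ≤ 1 := e4 ▸ (mean_mem_Icc _).2
  rcases htie with hs | htie
  · have := strictConcave_spread hs h0 hlt' b0 b1
    rw [purityGain_eq G f hpT, purityGain_eq G f hpT, ← hg, e1, e2, e3, e4] at hle
    have := le_of_mul_le_mul_left hle hp
    linarith
  · have := concave_spread hG.concave h0 hlt' b0 b1
    refine absurd (htie j (le_antisymm hle ?_)) (not_le.mpr hlt)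
    rw [purityGain_eq G f hpT, purityGain_eq G f hpT, ← hg, e1, e2, e3, e4]
    gcongr ?_ * ?_
    linarith

/-- Every internal node of the tree queries a most influential variable. -/
def QueriesMaxInfluence {α : Type} : ((Fin n → Bool) → Bool) → Tree n α → Prop
  | _, .leaf _ => True
  | g, .node i t₀ t₁ => (∀ j, influence g j ≤ influence g i) ∧
      QueriesMaxInfluence (fix g i false) t₀ ∧ QueriesMaxInfluence (fix g i true) t₁

theorem QueriesMaxInfluence.splitLeaf {g : (Fin n → Bool) → Bool} {T : BareTree n}
    (hT : QueriesMaxInfluence g T) {p : Path n} (hp : p ∈ T.leaves) {i : Fin n}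
    (hi : ∀ j, influence (restrict g p) j ≤ influence (restrict g p) i) :
    QueriesMaxInfluence g (T.splitLeaf p i) := by
  induction T generalizing g p with
  | leaf a =>
    simp only [Tree.leaves, List.mem_singleton] at hp
    subst hp
    exact ⟨hi, trivial, trivial⟩
  | node j t₀ t₁ ih₀ ih₁ =>
    simp only [Tree.leaves, List.mem_append, List.mem_map] at hp
    rcases hp with ⟨q, hq, rfl⟩ | ⟨q, hq, rfl⟩
    · exact ⟨hT.1, ih₀ hT.2.1 hq hi, hT.2.2⟩
    · exact ⟨hT.1, hT.2.1, ih₁ hT.2.2 hq hi⟩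

theorem QueriesMaxInfluence.completion {g f : (Fin n → Bool) → Bool} {T : BareTree n}
    (hT : QueriesMaxInfluence g T) : QueriesMaxInfluence g (completion f T) := by
  induction T generalizing g f with
  | leaf a => trivial
  | node j t₀ t₁ ih₀ ih₁ => exact ⟨hT.1, ih₀ hT.2.1, ih₁ hT.2.2⟩

/-- At unreachable leaves the gain says nothing, so the invariant also records that the subfunction
has no influential variable there. An unreachable leaf first arises by repeating a query, which has
influence 0; being a maximum, it forces all influences to be 0, and restriction preserves this. -/
theorem Grown.queriesMaxInfluence {G : ℝ → ℝ} (hG : IsImpurity G)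
    {f : (Fin n → Bool) → Bool} (hf : Monotone f) {ε : ℝ} {T : BareTree n}
    (hT : Grown G f ε T) :
    QueriesMaxInfluence f T ∧
      ∀ p ∈ T.leaves, reachProb p = 0 → ∀ j, influence (restrict f p) j = 0 := by
  induction hT with
  | start =>
    refine ⟨trivial, fun p hp h0 => ?_⟩
    simp only [Tree.leaves, List.mem_singleton] at hp
    subst hp
    rw [reachProb_eq_avg] at h0
    simp [ind, avg_const] at h0
  | grow T p i _ _ hs ih =>
    obtain ⟨ih1, ih2⟩ := ih
    have hp : p ∈ T.leaves := hs.1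
    have hmax : ∀ j, influence (restrict f p) j ≤ influence (restrict f p) i := by
      rcases (reachProb_nonneg p).eq_or_lt with h0 | h0
      · intro j
        rw [ih2 p hp h0.symm, ih2 p hp h0.symm]
      · exact influence_le_of_isGreedySplit hG hf hs h0
    refine ⟨ih1.splitLeaf hp hmax, fun q hq h0 => ?_⟩
    rcases mem_leaves_splitLeaf hp hq with hq | ⟨b, rfl⟩
    · exact ih2 q hq h0
    · intro j
      rw [restrict_append]
      refine influence_fix_eq_zero ?_ i b
      by_cases hi : i ∈ p.map Prod.fst
      · have := hmax j
        rw [influence_restrict_eq_zero hi] at this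
        exact le_antisymm this (influence_nonneg _ _)
      · rw [reachProb_snoc hi] at h0
        exact ih2 p hp (by linarith) j

end gain

end TopDown

namespace TopDown

/-! ### Binomial coefficients near the middle, and a Bernoulli-type bound -/

section binomial

/-- An elementary form of `centralBinom p ≥ 4^p / (2√p)`: the induction uses the ratio
`2(2p+1)/(p+1)` of successive terms and `4p(p+1) ≤ (2p+1)^2`. -/
theorem sixteen_pow_le_mul_sq_centralBinom {p : ℕ} (hp : 1 ≤ p) :
    16 ^ p ≤ 4 * p * p.centralBinom ^ 2 := by
  induction p, hp using Nat.le_induction with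
  | base => decide
  | succ p hp ih =>
    have h := Nat.succ_mul_centralBinom_succ p
    set A := p.centralBinom
    set B := (p + 1).centralBinom
    have h2 : (p + 1) * (4 * (p + 1) * B ^ 2) = 16 * (2 * p + 1) ^ 2 * A ^ 2 := by
      calc (p + 1) * (4 * (p + 1) * B ^ 2) = 4 * ((p + 1) * B) ^ 2 := by ring
        _ = _ := by rw [h]; ring
    refine le_of_mul_le_mul_left ?_ p.succ_pos
    rw [h2]
    calc (p + 1) * 16 ^ (p + 1) = 16 * (p + 1) * 16 ^ p := by ring
      _ ≤ 16 * (p + 1) * (4 * p * A ^ 2) := by gcongr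
      _ = 16 * (4 * p * (p + 1)) * A ^ 2 := by ring
      _ ≤ 16 * (2 * p + 1) ^ 2 * A ^ 2 := by gcongr; nlinarith

/-- Moving one step from the middle multiplies the coefficient by `(p-a)/(p+a+1)`. The factor `p -
a^2` fits the induction because `(p-a^2)(p-a) - (p-(a+1)^2)(p+a+1) = a^3 + (a+1)^3 ≥ 0`. -/
theorem centralBinom_mul_le_choose (p a : ℕ) (ha : a ≤ p) :
    ((p : ℝ) - a ^ 2) * p.centralBinom ≤ p * ((2 * p).choose (p + a) : ℝ) := by
  induction a with
  | zero => simp [Nat.centralBinom]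
  | succ a ih =>
    have ih := ih (by omega)
    have h := Nat.choose_succ_right_eq (2 * p) (p + a)
    rw [show 2 * p - (p + a) = p - a by omega] at h
    have h' : ((2 * p).choose (p + a + 1) : ℝ) * (p + a + 1) =
        (2 * p).choose (p + a) * ((p : ℝ) - a) := by
      have : ((p - a : ℕ) : ℝ) = (p : ℝ) - a := by rw [Nat.cast_sub (by omega)]
      rw [← this]
      exact_mod_cast h
    have hpa : (0 : ℝ) ≤ (p : ℝ) - a := by
      have : (a : ℝ) ≤ p := by exact_mod_cast (by omega : a ≤ p)
      linarith
    have hpos : (0 : ℝ) < p + a + 1 := by positivity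
    rw [← add_assoc]
    refine le_of_mul_le_mul_right ?_ hpos
    calc ((p : ℝ) - ((a + 1 : ℕ) : ℝ) ^ 2) * p.centralBinom * (p + a + 1)
        = ((p : ℝ) - (a + 1) ^ 2) * (p + a + 1) * p.centralBinom := by push_cast; ring
      _ ≤ ((p : ℝ) - a ^ 2) * (p - a) * p.centralBinom := by
          gcongr ?_ * _
          have : (0 : ℝ) ≤ (a : ℝ) ^ 3 + (a + 1) ^ 3 := by positivity
          nlinarith
      _ = ((p : ℝ) - a ^ 2) * p.centralBinom * (p - a) := by ring
      _ ≤ p * ((2 * p).choose (p + a) : ℝ) * (p - a) := by gcongr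
      _ = p * ((2 * p).choose (p + a + 1) : ℝ) * (p + a + 1) := by
          rw [mul_assoc, mul_assoc, h']

theorem centralBinom_le_two_mul_choose {p c : ℕ} (hp : 1 ≤ p)
    (hc : 2 * ((c : ℤ) - p) ^ 2 ≤ p) : (p.centralBinom : ℝ) ≤ 2 * (2 * p).choose c := by
  have main : ∀ a : ℕ, 2 * a ^ 2 ≤ p → (p.centralBinom : ℝ) ≤ 2 * (2 * p).choose (p + a) := by
    intro a ha
    have hap : a ≤ p := by nlinarith [Nat.zero_le a]
    have h := centralBinom_mul_le_choose p a hap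
    have h2 : (2 : ℝ) * a ^ 2 ≤ p := by exact_mod_cast ha
    have hp' : (0 : ℝ) < p := by exact_mod_cast hp
    have hcb : (0 : ℝ) ≤ p.centralBinom := by positivity
    refine le_of_mul_le_mul_left ?_ hp'
    nlinarith
  have hcp : (c : ℤ) ≤ 2 * p := by nlinarith [sq_nonneg ((c : ℤ) - p - 1)]
  rcases le_total p c with h | h
  · obtain ⟨a, rfl⟩ := Nat.exists_eq_add_of_le h
    refine main a ?_
    push_cast at hc
    have : 2 * ((a : ℤ)) ^ 2 ≤ p := by convert hc using 2; ring
    exact_mod_cast this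
  · obtain ⟨a, ha⟩ := Nat.exists_eq_add_of_le h
    have h1 : (2 * p).choose c = (2 * p).choose (p + a) := by
      rw [← Nat.choose_symm (by omega : p + a ≤ 2 * p)]
      congr 1
      omega
    rw [h1]
    refine main a ?_
    have : 2 * ((a : ℤ)) ^ 2 ≤ p := by
      convert hc using 2
      rw [ha]
      push_cast
      ring
    exact_mod_cast this

theorem centralBinom_div_ge {p K : ℕ} (hp : 1 ≤ p) (hK : p ≤ K ^ 2) :
    1 / (2 * K : ℝ) ≤ p.centralBinom / 4 ^ p := by
  have hK0 : 0 < K := by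
    rcases Nat.eq_zero_or_pos K with h | h
    · subst h; omega
    · exact h
  have h := sixteen_pow_le_mul_sq_centralBinom hp
  have h1 : (4 ^ p) ^ 2 ≤ (2 * K * p.centralBinom) ^ 2 := by
    calc (4 ^ p) ^ 2 = 16 ^ p := by rw [← pow_mul, mul_comm, pow_mul]; norm_num
      _ ≤ 4 * p * p.centralBinom ^ 2 := h
      _ ≤ 4 * K ^ 2 * p.centralBinom ^ 2 := by gcongr
      _ = _ := by ring
  have h2 : 4 ^ p ≤ 2 * K * p.centralBinom := (Nat.pow_le_pow_iff_left two_ne_zero).mp h1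
  have h3 : (4 : ℝ) ^ p ≤ 2 * K * p.centralBinom := by exact_mod_cast h2
  have hK' : (0 : ℝ) < K := by exact_mod_cast hK0
  rw [div_le_div_iff₀ (by positivity) (by positivity)]
  linarith

/-- Binomial coefficients near the middle have the order of magnitude of the central one. -/
theorem choose_div_two_pow_ge {m c K : ℕ} (hm : 7 ≤ m) (hK : m ≤ 2 * K ^ 2)
    (hc : 4 * (2 * (c : ℤ) - m) ^ 2 ≤ m) : 1 / (4 * K : ℝ) ≤ m.choose c / 2 ^ m := by
  rcases Nat.even_or_odd' m with ⟨p, rfl | rfl⟩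
  · have h1 := centralBinom_le_two_mul_choose (p := p) (c := c) (by omega) (by
      push_cast at hc; nlinarith)
    have h2 := centralBinom_div_ge (p := p) (K := K) (by omega) (by omega)
    rw [pow_mul]
    norm_num only
    calc 1 / (4 * K : ℝ) = 1 / (2 * K) / 2 := by rw [div_div]; ring_nf
      _ ≤ p.centralBinom / 4 ^ p / 2 := by gcongr
      _ ≤ 2 * (2 * p).choose c / 4 ^ p / 2 := by gcongr
      _ = _ := by ring
  · push_cast at hc
    have hc0 : 1 ≤ c := by
      by_contra h0
      have : c = 0 := by omega
      subst this
      push_cast at hc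
      nlinarith
    obtain ⟨c, rfl⟩ := Nat.exists_eq_add_of_le' hc0
    push_cast at hc
    have hp : (3 : ℤ) ≤ p := by omega
    have h1 := centralBinom_le_two_mul_choose (p := p) (c := c + 1) (by omega) (by
      push_cast; nlinarith [sq_nonneg (2 * ((c : ℤ) - p) - 1)])
    have h1' := centralBinom_le_two_mul_choose (p := p) (c := c) (by omega) (by
      nlinarith [sq_nonneg (2 * ((c : ℤ) - p) + 3)])
    have h2 := centralBinom_div_ge (p := p) (K := K) (by omega) (by omega)
    -- In the odd case Pascal's rule reduces to two coefficients in row `2p`, both near the middle.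
    rw [Nat.choose_succ_succ, pow_succ, pow_mul]
    norm_num only
    push_cast
    calc 1 / (4 * K : ℝ) = 1 / (2 * K) / 2 := by rw [div_div]; ring_nf
      _ ≤ p.centralBinom / 4 ^ p / 2 := by gcongr
      _ ≤ ((2 * p).choose c + (2 * p).choose (c + 1)) / 4 ^ p / 2 := by
        gcongr
        linarith
      _ = _ := by rw [div_div]

/-- Bernoulli's inequality for `(1+u)^M`, combined with `(1-u)^M (1+u)^M ≤ 1`. -/
theorem one_sub_pow_le {u : ℝ} (h0 : 0 ≤ u) (h1 : u ≤ 1) (M : ℕ) :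
    (1 - u) ^ M ≤ 1 / (1 + M * u) := by
  have hb := one_add_mul_le_pow (a := u) (by linarith) M
  have hp : 0 ≤ (1 - u) ^ M := pow_nonneg (by linarith) M
  rw [le_div_iff₀ (by positivity)]
  calc (1 - u) ^ M * (1 + M * u) ≤ (1 - u) ^ M * (1 + u) ^ M := by gcongr
    _ = (1 - u ^ 2) ^ M := by rw [← mul_pow]; ring_nf
    _ ≤ 1 := pow_le_one₀ (by nlinarith) (by nlinarith)

end binomial

/-! ### Partial assignments -/

/-- Extension of the input `x` by a partial assignment `σ`, which takes precedence. -/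
def override {n : ℕ} (σ : Fin n → Option Bool) (x : Fin n → Bool) : Fin n → Bool :=
  fun i => (σ i).getD (x i)

/-- The restriction of a function by a partial assignment. -/
def assign {n : ℕ} {α : Type} (f : (Fin n → Bool) → α) (σ : Fin n → Option Bool) :
    (Fin n → Bool) → α :=
  fun x => f (override σ x)

set_option linter.unusedSectionVars false

section override

variable {n : ℕ}

theorem override_update {σ : Fin n → Option Bool} {i : Fin n} (hi : σ i = none)
    (x : Fin n → Bool) (b : Bool) :
    override σ (Function.update x i b) = Function.update (override σ x) i b := by
  funext j
  by_cases hj : j = i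
  · subst hj; simp [override, hi]
  · simp [override, hj]

theorem override_update_some {σ : Fin n → Option Bool} {i : Fin n} (hi : σ i = none)
    (x : Fin n → Bool) (b : Bool) :
    override (Function.update σ i (some b)) x = override σ (Function.update x i b) := by
  funext j
  by_cases hj : j = i
  · subst hj; simp [override, hi]
  · simp [override, hj]

theorem override_update_of_ne_none {σ : Fin n → Option Bool} {i : Fin n} (hi : σ i ≠ none)
    (x : Fin n → Bool) (b : Bool) : override σ (Function.update x i b) = override σ x := by
  funext j
  by_cases hj : j = i
  · subst hj
    obtain ⟨c, hc⟩ := Option.ne_none_iff_exists'.mp hi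
    simp [override, hc]
  · simp [override, hj]

theorem fix_assign (f : (Fin n → Bool) → Bool) {σ : Fin n → Option Bool} {i : Fin n}
    (hi : σ i = none) (b : Bool) :
    fix (assign f σ) i b = assign f (Function.update σ i (some b)) := by
  funext x
  simp only [fix, assign, override_update_some hi]

end override

/-! ### The hard function: tribes that point to majority blocks -/

/-- A partition of some of the coordinates into tribes and blocks. Each tribe is either uncoloured,
or has a block as its colour. -/
structure Layout (n : ℕ) (τ β : Type) where
  /-- the tribe or block that contains a coordinate -/
  role : Fin n → Option (τ ⊕ β)
  /-- the block, if any, that a tribe points to -/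
  color : τ → Option β

namespace Layout

variable {n : ℕ} {τ β : Type} [DecidableEq τ] [DecidableEq β] (L : Layout n τ β)

/-- The coordinates of a tribe. -/
def tribe (t : τ) : Finset (Fin n) := Finset.univ.filter fun i => L.role i = some (.inl t)

/-- The coordinates of a block. -/
def block (j : β) : Finset (Fin n) := Finset.univ.filter fun i => L.role i = some (.inr j)

/-- All coordinates of the tribe are `1`. -/
def Sat (x : Fin n → Bool) (t : τ) : Prop := ∀ i ∈ L.tribe t, x i = true

/-- Some tribe of colour `j` is satisfied. -/
def Active (x : Fin n → Bool) (j : β) : Prop := ∃ t, L.color t = some j ∧ L.Sat x t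

/-- At least `h` coordinates of the block are `1`. -/
def Heavy (h : ℕ) (x : Fin n → Bool) (j : β) : Prop :=
  h ≤ ((L.block j).filter fun i => x i = true).card

/-- The function is `1` if an uncoloured tribe or tribes of two different colours are satisfied,
and the threshold function of block `j` if `j` is the only colour of the satisfied tribes. -/
def Accepts (h : ℕ) (x : Fin n → Bool) : Prop :=
  (∃ t, L.color t = none ∧ L.Sat x t) ∨ (∃ j j', j ≠ j' ∧ L.Active x j ∧ L.Active x j') ∨
    ∃ j, L.Active x j ∧ L.Heavy h x j

open Classical in
/-- The boolean function of a layout. -/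
noncomputable def func (h : ℕ) (x : Fin n → Bool) : Bool := decide (L.Accepts h x)

variable {L}

@[simp]
theorem mem_tribe {t : τ} {i : Fin n} : i ∈ L.tribe t ↔ L.role i = some (.inl t) := by
  simp [tribe]

@[simp]
theorem mem_block {j : β} {i : Fin n} : i ∈ L.block j ↔ L.role i = some (.inr j) := by
  simp [block]

theorem func_eq_true {h : ℕ} {x : Fin n → Bool} : L.func h x = true ↔ L.Accepts h x := by
  simp [func]

/-- Blocks need to agree only where they are active; this is why the function has a small tree. -/
theorem func_congr {h : ℕ} {x y : Fin n → Bool} (h1 : ∀ t, L.Sat x t ↔ L.Sat y t)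
    (h2 : ∀ j, L.Active x j → (L.Heavy h x j ↔ L.Heavy h y j)) : L.func h x = L.func h y := by
  have e1 : L.Sat x = L.Sat y := funext fun t => propext (h1 t)
  have e2 : L.Active x = L.Active y := by
    funext j; simp only [Active, e1]
  have : L.Accepts h x ↔ L.Accepts h y := by
    unfold Accepts
    rw [e1, e2]
    have : (∃ j, L.Active y j ∧ L.Heavy h x j) ↔ ∃ j, L.Active y j ∧ L.Heavy h y j := by
      refine exists_congr fun j => and_congr_right fun hj => h2 j (e2 ▸ hj)
    rw [this]
  rw [Bool.eq_iff_iff, func_eq_true, func_eq_true, this]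

theorem monotone_func (h : ℕ) : Monotone (L.func h) := by
  intro x y hxy
  have hb : ∀ i, x i = true → y i = true := fun i hi =>
    Bool.eq_true_of_true_le (hi ▸ hxy i)
  have hs : ∀ t, L.Sat x t → L.Sat y t := fun t H i hi => hb i (H i hi)
  have ha : ∀ j, L.Active x j → L.Active y j := fun j ⟨t, h1, h2⟩ => ⟨t, h1, hs t h2⟩
  have hh : ∀ j, L.Heavy h x j → L.Heavy h y j := fun j H => le_trans H (by
    refine Finset.card_le_card fun i hi => ?_
    rw [Finset.mem_filter] at hi ⊢
    exact ⟨hi.1, hb i hi.2⟩)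
  rw [Bool.le_iff_imp, func_eq_true, func_eq_true]
  rintro (⟨t, h1, h2⟩ | ⟨j, j', h1, h2, h3⟩ | ⟨j, h1, h2⟩)
  · exact Or.inl ⟨t, h1, hs t h2⟩
  · exact Or.inr (Or.inl ⟨j, j', h1, ha j h2, ha j' h3⟩)
  · exact Or.inr (Or.inr ⟨j, ha j h1, hh j h2⟩)

variable (L) in
/-- The partial assignment only sets variables that belong to blocks. -/
def OnBlocks (σ : Fin n → Option Bool) : Prop :=
  ∀ i, σ i ≠ none → ∃ j, L.role i = some (.inr j)

theorem OnBlocks.eq_none {σ : Fin n → Option Bool} (hσ : L.OnBlocks σ) {i : Fin n} {t : τ}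
    (hi : L.role i = some (.inl t)) : σ i = none := by
  by_contra h
  obtain ⟨j, hj⟩ := hσ i h
  simp [hi] at hj

theorem OnBlocks.sat_override {σ : Fin n → Option Bool} (hσ : L.OnBlocks σ) (x : Fin n → Bool)
    (t : τ) : L.Sat (override σ x) t ↔ L.Sat x t := by
  refine forall₂_congr fun i hi => ?_
  simp [override, hσ.eq_none (mem_tribe.mp hi)]

theorem sat_update {i : Fin n} {t : τ} (hi : L.role i ≠ some (.inl t)) (x : Fin n → Bool)
    (b : Bool) : L.Sat (Function.update x i b) t ↔ L.Sat x t := by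
  refine forall₂_congr fun j hj => ?_
  have : j ≠ i := by rintro rfl; exact hi (mem_tribe.mp hj)
  simp [this]

theorem heavy_update {h : ℕ} {i : Fin n} {j : β} (hi : L.role i ≠ some (.inr j))
    (x : Fin n → Bool) (b : Bool) : L.Heavy h (Function.update x i b) j ↔ L.Heavy h x j := by
  unfold Heavy
  have : ((L.block j).filter fun l => Function.update x i b l = true) =
      (L.block j).filter fun l => x l = true := by
    refine Finset.filter_congr fun l hl => ?_
    have : l ≠ i := by rintro rfl; exact hi (mem_block.mp hl)
    simp [this]
  rw [this]

/-- A tribe variable can matter only if all other variables of its tribe are 1. Settings of block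
variables do not affect this event. -/
theorem influence_tribe_le {σ : Fin n → Option Bool} (hσ : L.OnBlocks σ) {i : Fin n} {t : τ}
    (hi : L.role i = some (.inl t)) (h : ℕ) :
    influence (assign (L.func h) σ) i ≤ 2 * (1 / 2) ^ (L.tribe t).card := by
  have hmem : i ∈ L.tribe t := mem_tribe.mpr hi
  have hc : (L.tribe t).card = ((L.tribe t).erase i).card + 1 :=
    (Finset.card_erase_add_one hmem).symm
  rw [hc, pow_succ, influence_eq_avg]
  calc _ ≤ avg fun x => ind (∀ l ∈ (L.tribe t).erase i, x l = true) := by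
        refine avg_mono fun x => ind_mono fun hne => ?_
        by_contra hcon
        push Not at hcon
        obtain ⟨l, hl, hxl⟩ := hcon
        rw [Finset.mem_erase] at hl
        refine hne ?_
        unfold assign
        rw [override_update (hσ.eq_none hi)]
        set y := override σ x
        have hyl : y l ≠ true := by simpa [y, override, hσ.eq_none (mem_tribe.mp hl.2)] using hxl
        refine func_congr (fun t' => ?_) fun j _ => ?_
        · by_cases htt : t' = t
          · subst htt
            refine iff_of_false (fun H => hyl (H l hl.2)) fun H => hyl ?_
            simpa [hl.1] using H l hl.2
          · exact (sat_update (by simpa [hi] using fun e => htt e.symm) _ _).symm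
        · exact (heavy_update (by simp [hi]) _ _).symm
    _ = (1 / 2) ^ ((L.tribe t).erase i).card := avg_forall_true _
    _ = _ := by ring

theorem influence_eq_zero_of_role_none {i : Fin n} (hi : L.role i = none) (h : ℕ)
    (σ : Fin n → Option Bool) : influence (assign (L.func h) σ) i = 0 := by
  rw [influence_eq_zero_iff]
  intro x
  unfold assign
  by_cases hs : σ i = none
  · rw [override_update hs]
    refine func_congr (fun t => (sat_update (by simp [hi]) _ _).symm) fun j _ =>
      (heavy_update (by simp [hi]) _ _).symm
  · rw [override_update_of_ne_none hs]

theorem influence_eq_zero_of_ne_none {i : Fin n} {σ : Fin n → Option Bool} (hi : σ i ≠ none)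
    (f : (Fin n → Bool) → Bool) : influence (assign f σ) i = 0 := by
  rw [influence_eq_zero_iff]
  intro x
  unfold assign
  rw [override_update_of_ne_none hi]

theorem dependsOn_not_sat (U : Finset τ) :
    DependsOn (fun x => ind (∀ t ∈ U, ¬ L.Sat x t)) (U.biUnion L.tribe : Set (Fin n)) := by
  intro x y hxy
  have : ∀ t ∈ U, (L.Sat x t ↔ L.Sat y t) := fun t ht => by
    refine forall₂_congr fun i hi => ?_
    rw [hxy i (Finset.mem_coe.mpr (Finset.mem_biUnion.mpr ⟨t, ht, hi⟩))]
  simp only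
  congr 1
  exact propext (forall₂_congr fun t ht => not_congr (this t ht))

theorem disjoint_tribe {t t' : τ} (h : t ≠ t') : Disjoint (L.tribe t) (L.tribe t') := by
  rw [Finset.disjoint_left]
  intro i h1 h2
  rw [mem_tribe] at h1 h2
  rw [h1] at h2
  exact h (by simpa using h2)

theorem disjoint_tribe_block {t : τ} {j : β} : Disjoint (L.tribe t) (L.block j) := by
  rw [Finset.disjoint_left]
  intro i h1 h2
  rw [mem_tribe] at h1
  rw [mem_block, h1] at h2
  simp at h2

theorem disjoint_biUnion_tribe {U U' : Finset τ} (h : Disjoint U U') :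
    Disjoint (U.biUnion L.tribe) (U'.biUnion L.tribe) := by
  rw [Finset.disjoint_biUnion_left]
  intro t ht
  rw [Finset.disjoint_biUnion_right]
  intro t' ht'
  exact disjoint_tribe fun e => Finset.disjoint_left.mp h ht (e ▸ ht')

theorem avg_not_sat {w : ℕ} (hw : ∀ t, (L.tribe t).card = w) (U : Finset τ) :
    avg (fun x => ind (∀ t ∈ U, ¬ L.Sat x t)) = (1 - (1 / 2) ^ w) ^ U.card := by
  induction U using Finset.induction_on with
  | empty => simp [ind, avg_const]
  | insert t U ht ih =>
    have h1 : ∀ x, ind (∀ t' ∈ insert t U, ¬ L.Sat x t') =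
        ind (∀ t' ∈ ({t} : Finset τ), ¬ L.Sat x t') * ind (∀ t' ∈ U, ¬ L.Sat x t') := by
      intro x
      rw [← ind_and]
      simp
    simp only [h1]
    rw [avg_mul_of_disjoint (disjoint_biUnion_tribe (by simpa using ht)) (dependsOn_not_sat _)
      (dependsOn_not_sat _), ih, Finset.card_insert_of_notMem ht, pow_succ, mul_comm]
    congr 1
    have h2 : ∀ x, ind (∀ t' ∈ ({t} : Finset τ), ¬ L.Sat x t') =
        1 - ind (∀ i ∈ L.tribe t, x i = true) := by
      intro x
      rw [← ind_not]
      simp [Sat]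
    simp only [h2]
    rw [avg_sub, avg_const, avg_forall_true, hw]

section counts

variable (L) in
/-- The variables of the block that the partial assignment leaves free. -/
def free (σ : Fin n → Option Bool) (j : β) : Finset (Fin n) :=
  (L.block j).filter fun i => σ i = none

variable (L) in
/-- The number of variables of the block that are set to `b`. -/
def count (σ : Fin n → Option Bool) (j : β) (b : Bool) : ℕ :=
  ((L.block j).filter fun i => σ i = some b).card

theorem card_free_add (σ : Fin n → Option Bool) (j : β) :
    (L.free σ j).card + L.count σ j true + L.count σ j false = (L.block j).card := by
  have h1 := Finset.card_filter_add_card_filter_not (s := L.block j) fun i => σ i = none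
  have h2 := Finset.card_filter_add_card_filter_not
    (s := (L.block j).filter fun i => ¬ σ i = none) fun i => σ i = some true
  have h3 : (((L.block j).filter fun i => ¬ σ i = none).filter fun i => σ i = some true) =
      (L.block j).filter fun i => σ i = some true := by
    ext i; simp only [Finset.mem_filter]; cases σ i <;> simp
  have h4 : (((L.block j).filter fun i => ¬ σ i = none).filter fun i => ¬ σ i = some true) =
      (L.block j).filter fun i => σ i = some false := by
    ext i; simp only [Finset.mem_filter]
    rcases σ i with _ | (_ | _) <;> simp
  rw [h3, h4] at h2
  unfold free count
  omega

theorem card_override_true (σ : Fin n → Option Bool) (j : β) (x : Fin n → Bool) :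
    ((L.block j).filter fun i => override σ x i = true).card =
      L.count σ j true + ((L.free σ j).filter fun i => x i = true).card := by
  have h1 : ((L.block j).filter fun i => override σ x i = true) =
      ((L.block j).filter fun i => σ i = some true) ∪
        ((L.free σ j).filter fun i => x i = true) := by
    ext i
    rw [Finset.mem_filter, Finset.mem_union, Finset.mem_filter, Finset.mem_filter, free,
      Finset.mem_filter]
    unfold override
    cases σ i <;> simp
  rw [h1, Finset.card_union_of_disjoint]
  · rfl
  · rw [Finset.disjoint_left]
    intro i hi hi'
    simp only [Finset.mem_filter, free] at hi hi'
    rw [hi'.1.2] at hi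
    simp at hi

end counts

/-- The situation in which block variables matter: `j` is the only active colour and no uncoloured
tribe is satisfied. -/
theorem func_eq_decide_heavy {h : ℕ} {x : Fin n → Bool} {j : β}
    (h1 : ∀ t, L.color t ≠ some j → ¬ L.Sat x t) (h2 : L.Active x j) :
    L.func h x = true ↔ L.Heavy h x j := by
  have hj : ∀ j', L.Active x j' → j' = j := by
    rintro j' ⟨t, ht, hs⟩
    by_contra hne
    exact h1 t (by rw [ht]; simpa using hne) hs
  rw [func_eq_true]
  constructor
  · rintro (⟨t, ht, hs⟩ | ⟨j₁, j₂, hne, ha, hb⟩ | ⟨j', ha, hb⟩)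
    · exact absurd hs (h1 t (by simp [ht]))
    · exact absurd ((hj _ ha).trans (hj _ hb).symm) hne
    · exact hj _ ha ▸ hb
  · exact fun H => Or.inr (Or.inr ⟨j, h2, H⟩)

variable [Fintype τ]

/-- Three independent events make `x_i` decide the value: no tribe outside colour `j` is satisfied,
some tribe of colour `j` is, and the other free variables of the block leave the threshold short by
exactly one. The factors on the left bound their probabilities, the first crudely by counting all
tribes. -/
theorem influence_block_ge {σ : Fin n → Option Bool} (hσ : L.OnBlocks σ) {i : Fin n} {j : β}
    (hi : L.role i = some (.inr j)) (hs : σ i = none) {w M h c : ℕ}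
    (hw : ∀ t, (L.tribe t).card = w)
    (hM : (Finset.univ.filter fun t => L.color t = some j).card = M)
    (hc : L.count σ j true + c + 1 = h) :
    (1 - (1 / 2) ^ w) ^ Fintype.card τ * (1 - (1 - (1 / 2) ^ w) ^ M) *
      ((((L.free σ j).card - 1).choose c : ℝ) / 2 ^ ((L.free σ j).card - 1)) ≤
      influence (assign (L.func h) σ) i := by
  set U₁ : Finset τ := Finset.univ.filter fun t => L.color t ≠ some j with hU₁
  set U₂ : Finset τ := Finset.univ.filter fun t => L.color t = some j with hU₂
  set A := (L.free σ j).erase i with hA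
  have hif : i ∈ L.free σ j := by simp [free, hi, hs]
  have hAc : A.card = (L.free σ j).card - 1 := Finset.card_erase_of_mem hif
  have hu0 : (0 : ℝ) ≤ 1 - (1 / 2) ^ w := by
    have : (1 / 2 : ℝ) ^ w ≤ 1 := pow_le_one₀ (by norm_num) (by norm_num)
    linarith
  have hu1 : (1 : ℝ) - (1 / 2) ^ w ≤ 1 := by
    have : (0 : ℝ) ≤ (1 / 2 : ℝ) ^ w := by positivity
    linarith
  have hdep3 : DependsOn (fun x : Fin n → Bool =>
      ind ((A.filter fun l => x l = true).card = c)) (A : Set (Fin n)) := by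
    intro x y hxy
    have : (A.filter fun l => x l = true) = A.filter fun l => y l = true :=
      Finset.filter_congr fun l hl => by rw [hxy l hl]
    simp only [this]
  have hdep2 : DependsOn (fun x => 1 - ind (∀ t ∈ U₂, ¬ L.Sat x t))
      (U₂.biUnion L.tribe : Set (Fin n)) := by
    intro x y hxy
    exact congrArg (fun z => 1 - z) (dependsOn_not_sat U₂ hxy)
  have hAb : A ⊆ L.block j := (Finset.erase_subset _ _).trans (Finset.filter_subset _ _)
  have hdis : Disjoint (U₂.biUnion L.tribe) A := by
    rw [Finset.disjoint_biUnion_left]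
    exact fun t _ => disjoint_tribe_block.mono_right hAb
  have hdis' : Disjoint (U₁.biUnion L.tribe) (U₂.biUnion L.tribe ∪ A) := by
    rw [Finset.disjoint_union_right]
    refine ⟨disjoint_biUnion_tribe ?_, ?_⟩
    · rw [Finset.disjoint_left]
      intro t h1 h2
      exact (Finset.mem_filter.mp h1).2 (Finset.mem_filter.mp h2).2
    · rw [Finset.disjoint_biUnion_left]
      exact fun t _ => disjoint_tribe_block.mono_right hAb
  have hdep23 : DependsOn (fun x => (1 - ind (∀ t ∈ U₂, ¬ L.Sat x t)) *
      ind ((A.filter fun l => x l = true).card = c))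
      ((U₂.biUnion L.tribe ∪ A : Finset (Fin n)) : Set (Fin n)) := by
    intro x y hxy
    have h2 := hdep2 (x := x) (y := y) fun l hl => hxy l (by
      rw [Finset.coe_union]; exact Or.inl hl)
    have h3 := hdep3 (x := x) (y := y) fun l hl => hxy l (by
      rw [Finset.coe_union]; exact Or.inr hl)
    simp only at h2 h3 ⊢
    rw [h2, h3]
  have e := avg_mul_of_disjoint hdis' (dependsOn_not_sat U₁) hdep23
  rw [avg_mul_of_disjoint hdis hdep2 hdep3, avg_sub, avg_const, avg_not_sat hw, avg_not_sat hw,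
    avg_card_eq, hM, hAc] at e
  have hU₁c : U₁.card ≤ Fintype.card τ := Finset.card_le_univ _
  calc _ = (1 - (1 / 2) ^ w) ^ Fintype.card τ * ((1 - (1 - (1 / 2) ^ w) ^ M) *
      ((((L.free σ j).card - 1).choose c : ℝ) / 2 ^ ((L.free σ j).card - 1))) := by ring
    _ ≤ (1 - (1 / 2) ^ w) ^ U₁.card * ((1 - (1 - (1 / 2) ^ w) ^ M) *
      ((((L.free σ j).card - 1).choose c : ℝ) / 2 ^ ((L.free σ j).card - 1))) := by
        refine mul_le_mul_of_nonneg_right (pow_le_pow_of_le_one hu0 hu1 hU₁c) ?_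
        refine mul_nonneg ?_ (by positivity)
        linarith [pow_le_one₀ (n := M) hu0 hu1]
    _ = _ := e.symm
    _ ≤ _ := by
      rw [influence_eq_avg]
      refine avg_mono fun x => ?_
      rw [← ind_not, ← ind_and, ← ind_and]
      refine ind_mono ?_
      rintro ⟨h1, h2, h3⟩
      push Not at h2
      obtain ⟨t, ht, hst⟩ := h2
      have key : ∀ b, assign (L.func h) σ (Function.update x i b) = b := by
        intro b
        have hsat : ∀ t, L.Sat (override σ (Function.update x i b)) t ↔ L.Sat x t := fun t => by
          rw [hσ.sat_override, sat_update (by simp [hi])]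
        rw [Bool.eq_iff_iff]
        unfold assign
        rw [func_eq_decide_heavy (j := j)
          (fun t ht => by
            rw [hsat]; exact h1 t (Finset.mem_filter.mpr ⟨Finset.mem_univ _, ht⟩))
          ⟨t, (Finset.mem_filter.mp ht).2, (hsat t).mpr hst⟩]
        unfold Heavy
        rw [card_override_true, ← Finset.insert_erase hif,
          filter_update_card (Finset.notMem_erase _ _), h3]
        cases b <;> simp <;> omega
      have k1 := key (x i)
      rw [Function.update_eq_self] at k1
      rw [k1, key]
      simp

/-- With no satisfied tribe the value is 0, however the blocks are set. Together with `mean_ge` this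
keeps every subfunction reached through block queries nearly balanced. -/
theorem one_sub_mean_ge {w : ℕ} (hw : ∀ t, (L.tribe t).card = w) {σ : Fin n → Option Bool}
    (hσ : L.OnBlocks σ) (h : ℕ) :
    (1 - (1 / 2) ^ w) ^ Fintype.card τ ≤ 1 - mean (assign (L.func h) σ) := by
  rw [mean_eq_avg, ← Finset.card_univ, ← avg_not_sat hw]
  have : (1 : ℝ) = avg (fun _ : Fin n → Bool => (1 : ℝ)) := (avg_const 1).symm
  rw [this, ← avg_sub]
  refine avg_mono fun x => ?_
  rw [← ind_not]
  refine ind_mono fun H => ?_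
  unfold assign
  rw [func_eq_true]
  have hn : ∀ t, ¬ L.Sat (override σ x) t := fun t => by
    rw [hσ.sat_override]; exact H t (Finset.mem_univ t)
  rintro (⟨t, -, hs⟩ | ⟨j, -, -, ⟨t, -, hs⟩, -⟩ | ⟨j, ⟨t, -, hs⟩, -⟩) <;> exact hn t hs

theorem mean_ge {w N : ℕ} (hw : ∀ t, (L.tribe t).card = w)
    (hN : (Finset.univ.filter fun t => L.color t = none).card = N) {σ : Fin n → Option Bool}
    (hσ : L.OnBlocks σ) (h : ℕ) :
    1 - (1 - (1 / 2) ^ w) ^ N ≤ mean (assign (L.func h) σ) := by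
  rw [mean_eq_avg, ← hN, ← avg_not_sat hw]
  have : (1 : ℝ) = avg (fun _ : Fin n → Bool => (1 : ℝ)) := (avg_const 1).symm
  rw [this, ← avg_sub]
  refine avg_mono fun x => ?_
  rw [← ind_not]
  refine ind_mono fun H => ?_
  push Not at H
  obtain ⟨t, ht, hs⟩ := H
  unfold assign
  rw [func_eq_true]
  exact Or.inl ⟨t, (Finset.mem_filter.mp ht).2, (hσ.sat_override x t).mpr hs⟩

end Layout

end TopDown

namespace TopDown

set_option linter.unusedSectionVars false

theorem Tree.one_le_size {n : ℕ} {α : Type} (T : Tree n α) : 1 ≤ T.size := by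
  induction T with
  | leaf => exact le_rfl
  | node i t₀ t₁ h₀ h₁ => exact h₀.trans (Nat.le_add_right _ _)

namespace Layout

variable {n : ℕ} {τ β : Type} [DecidableEq τ] [DecidableEq β] {L : Layout n τ β}

/-! ### The potential of a partial assignment and the martingale argument -/

section potential

theorem count_update_self {σ : Fin n → Option Bool} {i : Fin n} {j : β}
    (hi : L.role i = some (.inr j)) (hs : σ i = none) (b c : Bool) :
    L.count (Function.update σ i (some b)) j c = L.count σ j c + if b = c then 1 else 0 := by
  unfold count
  have h1 : ((L.block j).filter fun l => Function.update σ i (some b) l = some c) =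
      if b = c then insert i ((L.block j).filter fun l => σ l = some c)
        else (L.block j).filter fun l => σ l = some c := by
    ext l
    by_cases hl : l = i
    · subst hl
      by_cases hb : b = c <;> simp [hb, hi, hs]
    · by_cases hb : b = c <;> simp [hb, hl]
  rw [h1]
  split_ifs
  · rw [Finset.card_insert_of_notMem (by simp [hs])]
  · rfl

theorem count_update_of_ne {σ : Fin n → Option Bool} {i : Fin n} {j : β}
    (hi : L.role i ≠ some (.inr j)) (o : Option Bool) (c : Bool) :
    L.count (Function.update σ i o) j c = L.count σ j c := by
  unfold count
  congr 1
  refine Finset.filter_congr fun l hl => ?_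
  have : l ≠ i := by rintro rfl; exact hi (mem_block.mp hl)
  simp [this]

variable [Fintype β]

variable (L) in
/-- The number of block variables that are set. -/
def queried (σ : Fin n → Option Bool) : ℕ := ∑ j, (L.count σ j true + L.count σ j false)

variable (L) in
/-- The sum over the blocks of the squares of the differences between the numbers of variables
set to `1` and to `0`. -/
noncomputable def potential (σ : Fin n → Option Bool) : ℝ :=
  ∑ j, ((L.count σ j true : ℝ) - L.count σ j false) ^ 2

theorem queried_update {σ : Fin n → Option Bool} {i : Fin n} {j : β}
    (hi : L.role i = some (.inr j)) (hs : σ i = none) (b : Bool) :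
    L.queried (Function.update σ i (some b)) = L.queried σ + 1 := by
  unfold queried
  rw [← Finset.add_sum_erase _ _ (Finset.mem_univ j),
    ← Finset.add_sum_erase (f := fun j => L.count σ j true + L.count σ j false) _
      (Finset.mem_univ j), count_update_self hi hs, count_update_self hi hs]
  rw [Finset.sum_congr rfl fun l hl => by
    rw [count_update_of_ne (j := l), count_update_of_ne (j := l)] <;>
    · rw [hi]
      have := (Finset.mem_erase.mp hl).1
      simpa using this.symm]
  cases b <;> simp <;> ring

/-- A fair ±1 step from imbalance `d`: `(d-1)^2 + (d+1)^2 = 2d^2 + 2`. -/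
theorem potential_update {σ : Fin n → Option Bool} {i : Fin n} {j : β}
    (hi : L.role i = some (.inr j)) (hs : σ i = none) :
    L.potential (Function.update σ i (some false)) + L.potential (Function.update σ i (some true)) =
      2 * L.potential σ + 2 := by
  have key : ∀ b, L.potential (Function.update σ i (some b)) =
      ((L.count σ j true : ℝ) - L.count σ j false + if b then 1 else -1) ^ 2 +
        ∑ l ∈ Finset.univ.erase j, ((L.count σ l true : ℝ) - L.count σ l false) ^ 2 := by
    intro b
    unfold potential
    rw [← Finset.add_sum_erase _ _ (Finset.mem_univ j), count_update_self hi hs,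
      count_update_self hi hs]
    rw [Finset.sum_congr rfl fun l hl => by
      rw [count_update_of_ne (j := l), count_update_of_ne (j := l)] <;>
      · rw [hi]
        have := (Finset.mem_erase.mp hl).1
        simpa using this.symm]
    cases b <;> simp <;> ring
  rw [key, key]
  unfold potential
  rw [← Finset.add_sum_erase (f := fun j => ((L.count σ j true : ℝ) - L.count σ j false) ^ 2) _
    (Finset.mem_univ j)]
  simp
  ring

theorem potential_nonneg (σ : Fin n → Option Bool) : 0 ≤ L.potential σ :=
  Finset.sum_nonneg fun _ _ => sq_nonneg _

theorem queried_none : L.queried (fun _ => none) = 0 := by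
  simp [queried, count]

theorem potential_none : L.potential (fun _ => none) = 0 := by
  simp [potential, count]

theorem OnBlocks.update {σ : Fin n → Option Bool} (hσ : L.OnBlocks σ) {i : Fin n} {j : β}
    (hi : L.role i = some (.inr j)) (o : Option Bool) : L.OnBlocks (Function.update σ i o) := by
  intro l hl
  by_cases h : l = i
  · exact ⟨j, h ▸ hi⟩
  · exact hσ l (by simpa [h] using hl)

/-- The martingale argument: along the path of a random input, the potential grows by one in
expectation with each query to a block, so if it has to be large wherever the tree can query
anything else, then most paths are long. -/
theorem one_le_of_queriesMaxInfluence {f : (Fin n → Bool) → Bool} {α κ : ℝ} {D : ℕ}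
    (hα : 0 ≤ α) (hκ : 0 ≤ κ)
    (hmean : ∀ σ, L.OnBlocks σ →
      1 ≤ α * mean (assign f σ) ∧ 1 ≤ α * (1 - mean (assign f σ)))
    (hquery : ∀ σ, L.OnBlocks σ → L.queried σ < D → 1 ≤ κ * L.potential σ ∨
      ∀ i, (∀ l, influence (assign f σ) l ≤ influence (assign f σ) i) →
        σ i = none ∧ ∃ j, L.role i = some (.inr j))
    (A : DecisionTree n) (σ : Fin n → Option Bool) (hσ : L.OnBlocks σ) (hq : L.queried σ ≤ D)
    (hA : QueriesMaxInfluence (assign f σ) A) :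
    1 ≤ α * avg (fun x => ind (assign A.eval σ x ≠ assign f σ x)) +
      A.size / 2 ^ (D - L.queried σ) + κ * (L.potential σ + ((D : ℝ) - L.queried σ)) := by
  induction A generalizing σ with
  | leaf b =>
    have hD : (0 : ℝ) ≤ (D : ℝ) - L.queried σ := by
      have : (L.queried σ : ℝ) ≤ D := by exact_mod_cast hq
      linarith
    have h1 : (0 : ℝ) ≤ κ * (L.potential σ + ((D : ℝ) - L.queried σ)) :=
      mul_nonneg hκ (add_nonneg (potential_nonneg σ) hD)
    have h2 : (0 : ℝ) ≤ (Tree.leaf b : DecisionTree n).size / 2 ^ (D - L.queried σ) := by positivity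
    obtain ⟨m1, m2⟩ := hmean σ hσ
    rw [mean_eq_avg] at m1 m2
    -- A constant label errs with probability the mean or its complement, so at a leaf the error
    -- term alone reaches 1.
    have h3 : 1 ≤ α * avg fun x => ind (assign (Tree.leaf b).eval σ x ≠ assign f σ x) := by
      cases b
      · refine m1.trans_eq ?_
        congr 2
        funext x
        congr 1
        simp only [assign, Tree.eval]
        cases f (override σ x) <;> simp
      · refine m2.trans_eq ?_
        rw [← avg_const (n := n) 1, ← avg_sub]
        congr 2
        funext x
        rw [← ind_not]
        simp only [assign, Tree.eval]
        cases f (override σ x) <;> simp [ind]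
    linarith
  | node i t₀ t₁ ih₀ ih₁ =>
    have hE : 0 ≤ α * avg (fun x => ind (assign (Tree.node i t₀ t₁).eval σ x ≠ assign f σ x)) :=
      mul_nonneg hα (avg_nonneg fun _ => ind_nonneg _)
    have hs := (Tree.node i t₀ t₁).one_le_size
    -- Once `D` block variables are set, the size term alone reaches 1.
    rcases hq.eq_or_lt with heq | hlt
    · rw [heq]
      have : 0 ≤ κ * L.potential σ := mul_nonneg hκ (potential_nonneg σ)
      have hs' : (1 : ℝ) ≤ (Tree.node i t₀ t₁).size := by exact_mod_cast hs
      simp only [Nat.sub_self, pow_zero, div_one, sub_self, add_zero]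
      linarith
    · have hlt' : (L.queried σ : ℝ) + 1 ≤ D := by exact_mod_cast hlt
      -- Either the potential term alone reaches 1, or the query is to a free block variable and the
      -- bounds for the two children are averaged: errors average, sizes add while the power of two
      -- doubles, and the expected gain of 1 in potential offsets the loss of 1 in `D - queried`.
      rcases hquery σ hσ hlt with hdead | halive
      · have h2 : (0 : ℝ) ≤ (Tree.node i t₀ t₁).size / 2 ^ (D - L.queried σ) := by positivity
        have : 0 ≤ κ * ((D : ℝ) - L.queried σ) := mul_nonneg hκ (by linarith)
        linarith
      · obtain ⟨hmax, hA₀, hA₁⟩ := hA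
        obtain ⟨hi, j, hj⟩ := halive i hmax
        rw [fix_assign f hi] at hA₀ hA₁
        have q := queried_update hj hi
        have b₀ := ih₀ _ (hσ.update hj _) (by rw [q]; exact hlt) hA₀
        have b₁ := ih₁ _ (hσ.update hj _) (by rw [q]; exact hlt) hA₁
        have e : ∀ (b : Bool) (x : Fin n → Bool),
            ind (assign (Tree.node i t₀ t₁).eval σ (Function.update x i b) ≠
              assign f σ (Function.update x i b)) =
            ind (assign (if b = true then t₁ else t₀).eval (Function.update σ i (some b)) x ≠
              assign f (Function.update σ i (some b)) x) := by
          intro b x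
          unfold assign
          rw [override_update_some hi, override_update hi]
          cases b <;> simp [Tree.eval]
        rw [avg_cond i]
        simp only [e, Bool.false_eq_true, if_true, if_false]
        have hp := potential_update hj hi
        rw [q] at b₀ b₁
        obtain ⟨d, hd⟩ := Nat.exists_eq_add_of_lt hlt
        have d1 : D - L.queried σ = d + 1 := by omega
        have d2 : D - (L.queried σ + 1) = d := by omega
        rw [d2] at b₀ b₁
        rw [d1, pow_succ]
        push_cast at b₀ b₁
        have hsz : ((Tree.node i t₀ t₁).size : ℝ) / (2 ^ d * 2) =
            (t₀.size / 2 ^ d + t₁.size / 2 ^ d) / 2 := by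
          simp only [Tree.size]
          push_cast
          rw [← add_div, div_div]
        rw [hsz]
        have hp' := congrArg (fun z => κ * z) hp
        linarith

end potential

/-! ### Live blocks and the lower bound for a layout -/

section alive

variable [Fintype τ] [Fintype β]

/-- As long as a block has few variables set, and those not too unbalanced, its free variables are
more influential than all variables outside of the blocks. -/
theorem block_of_isMax_influence {w M k K B : ℕ}
    (hw : ∀ t, (L.tribe t).card = w) (hk : ∀ j, (L.block j).card = k)
    (hM : ∀ j, (Finset.univ.filter fun t => L.color t = some j).card = M)
    (hk2 : 2 ∣ k) (hk64 : 64 ≤ k) (hkK : k ≤ 2 * K ^ 2) (hB : 4 ≤ B)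
    (hinf : 2 * (1 / 2 : ℝ) ^ w < (1 - (1 / 2) ^ w) ^ Fintype.card τ *
      (1 - (1 - (1 / 2) ^ w) ^ M) * (1 / (4 * K)))
    {σ : Fin n → Option Bool} (hσ : L.OnBlocks σ) {j : β}
    (h1 : 64 * ((L.count σ j true : ℤ) - L.count σ j false) ^ 2 < k)
    (h2 : B * (L.count σ j true + L.count σ j false) < k) {i : Fin n}
    (hi : ∀ l, influence (assign (L.func (k / 2)) σ) l ≤
      influence (assign (L.func (k / 2)) σ) i) :
    σ i = none ∧ ∃ j, L.role i = some (.inr j) := by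
  have hfree := card_free_add (L := L) σ j
  rw [hk] at hfree
  have h4 : 4 * (L.count σ j true + L.count σ j false) < k :=
    lt_of_le_of_lt (Nat.mul_le_mul_right _ hB) h2
  obtain ⟨k', rfl⟩ := hk2
  have hkh : 2 * k' / 2 = k' := by omega
  obtain ⟨l, hl⟩ : (L.free σ j).Nonempty := Finset.card_pos.mp (by omega)
  obtain ⟨hlb, hls⟩ := Finset.mem_filter.mp hl
  have hge := influence_block_ge hσ (mem_block.mp hlb) hls (h := k')
    (c := k' - 1 - L.count σ j true) hw (hM j) (by omega)
  have hch : (1 : ℝ) / (4 * K) ≤ (((L.free σ j).card - 1).choose (k' - 1 - L.count σ j true) : ℝ) /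
      2 ^ ((L.free σ j).card - 1) := by
    -- With `S` the imbalance, the required count is off the middle of the remaining `m` free
    -- variables by `(S+1)/2`. Here `64 S^2 < k`, `m ≥ 3k/4 - 1` and `k ≥ 64` give `4(S+1)^2 ≤ m`.
    refine choose_div_two_pow_ge (by omega) (by omega) ?_
    have e : 2 * ((k' - 1 - L.count σ j true : ℕ) : ℤ) - ((L.free σ j).card - 1 : ℕ) =
        -((L.count σ j true : ℤ) - L.count σ j false + 1) := by omega
    rw [e]
    have hm : ((L.free σ j).card - 1 : ℕ) =
        (2 * k' : ℤ) - L.count σ j true - L.count σ j false - 1 := by omega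
    rw [hm]
    push_cast at h1
    set S := (L.count σ j true : ℤ) - L.count σ j false with hS
    have h5 : 4 * ((L.count σ j true : ℤ) + L.count σ j false) < 2 * k' := by exact_mod_cast h4
    have h6 : (64 : ℤ) ≤ 2 * k' := by exact_mod_cast hk64
    nlinarith [sq_nonneg (S - 1)]
  have hu1 : (1 / 2 : ℝ) ^ w ≤ 1 := pow_le_one₀ (by norm_num) (by norm_num)
  have hu0 : (0 : ℝ) ≤ (1 / 2 : ℝ) ^ w := by positivity
  have hlt : 2 * (1 / 2 : ℝ) ^ w < influence (assign (L.func (2 * k' / 2)) σ) i := by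
    refine hinf.trans_le (le_trans ?_ (hi l))
    rw [hkh]
    refine le_trans ?_ hge
    refine mul_le_mul_of_nonneg_left hch (mul_nonneg (pow_nonneg (by linarith) _) ?_)
    linarith [pow_le_one₀ (n := M) (by linarith : (0 : ℝ) ≤ 1 - (1 / 2) ^ w) (by linarith)]
  have hσi : σ i = none := by
    by_contra hne
    rw [influence_eq_zero_of_ne_none hne] at hlt
    linarith
  refine ⟨hσi, ?_⟩
  rcases hr : L.role i with _ | (t | j)
  · rw [influence_eq_zero_of_role_none hr] at hlt
    linarith
  · have := influence_tribe_le hσ hr (2 * k' / 2)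
    rw [hw] at this
    linarith
  · exact ⟨j, rfl⟩

/-- The martingale bound at the empty assignment: the error contributes `α ε`, the size `A.size /
2^D`, and the potential at most `64 / B`. The latter corresponds to the chance that all blocks are
spoilt within `D` queries. -/
theorem size_ge_of_queriesMaxInfluence {w M N k K B D : ℕ}
    (hw : ∀ t, (L.tribe t).card = w) (hk : ∀ j, (L.block j).card = k)
    (hM : ∀ j, (Finset.univ.filter fun t => L.color t = some j).card = M)
    (hN : (Finset.univ.filter fun t => L.color t = none).card = N)
    (hk2 : 2 ∣ k) (hk64 : 64 ≤ k) (hkK : k ≤ 2 * K ^ 2) (hB : 4 ≤ B)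
    (hinf : 2 * (1 / 2 : ℝ) ^ w < (1 - (1 / 2) ^ w) ^ Fintype.card τ *
      (1 - (1 - (1 / 2) ^ w) ^ M) * (1 / (4 * K)))
    (hD : 2 * B * D ≤ Fintype.card β * k) (hβ : 0 < Fintype.card β) {α ε : ℝ} (hα : 0 ≤ α)
    (hα1 : 1 ≤ α * (1 - (1 - (1 / 2) ^ w) ^ N))
    (hα2 : 1 ≤ α * (1 - (1 / 2) ^ w) ^ Fintype.card τ)
    {A : DecisionTree n} (hA : QueriesMaxInfluence (L.func (k / 2)) A)
    (herr : error A.eval (L.func (k / 2)) ≤ ε) :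
    (1 - α * ε - 64 / B) * 2 ^ D ≤ A.size := by
  have hB0 : (0 : ℝ) < B := by exact_mod_cast (by omega : 0 < B)
  have hk0 : (0 : ℝ) < k := by exact_mod_cast (by omega : 0 < k)
  have hr0 : (0 : ℝ) < Fintype.card β := by exact_mod_cast hβ
  have hD' : 2 * B * D ≤ (Fintype.card β : ℝ) * k := by exact_mod_cast hD
  have hroot := one_le_of_queriesMaxInfluence (L := L) (f := L.func (k / 2)) (α := α)
    (κ := 128 / (Fintype.card β * k)) (D := D) hα (by positivity)
    (fun σ hσ => ⟨hα1.trans (mul_le_mul_of_nonneg_left (mean_ge hw hN hσ _) hα),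
      hα2.trans (mul_le_mul_of_nonneg_left (one_sub_mean_ge hw hσ _) hα)⟩)
    (by
      intro σ hσ hq
      by_cases halive : ∃ j, 64 * ((L.count σ j true : ℤ) - L.count σ j false) ^ 2 < k ∧
        B * (L.count σ j true + L.count σ j false) < k
      · obtain ⟨j, h1, h2⟩ := halive
        exact Or.inr fun i hi =>
          block_of_isMax_influence hw hk hM hk2 hk64 hkK hB hinf hσ h1 h2 hi
      · left
        push Not at halive
        -- A spoilt block is too unbalanced or has too many variables set, so one of the two terms
        -- is at least `k`. Summed over the blocks, the second terms give at most `B D`, half of the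
        -- total, so the potential is at least `card β * k / 128`; hence the factor `128 / (card β *
        -- k)`.
        have hj : ∀ j ∈ (Finset.univ : Finset β), (k : ℝ) ≤
            64 * ((L.count σ j true : ℝ) - L.count σ j false) ^ 2 +
              B * ((L.count σ j true + L.count σ j false : ℕ) : ℝ) := by
          intro j _
          by_cases h : 64 * ((L.count σ j true : ℤ) - L.count σ j false) ^ 2 < k
          · have h' : (k : ℝ) ≤ B * ((L.count σ j true + L.count σ j false : ℕ) : ℝ) := by
              exact_mod_cast halive j h
            have : (0 : ℝ) ≤ 64 * ((L.count σ j true : ℝ) - L.count σ j false) ^ 2 := by positivity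
            linarith
          · have h' : (k : ℝ) ≤ 64 * ((L.count σ j true : ℝ) - L.count σ j false) ^ 2 := by
              exact_mod_cast not_lt.mp h
            have : (0 : ℝ) ≤ B * ((L.count σ j true + L.count σ j false : ℕ) : ℝ) := by positivity
            linarith
        have hsum := Finset.sum_le_sum hj
        rw [Finset.sum_const, Finset.card_univ, nsmul_eq_mul, Finset.sum_add_distrib,
          ← Finset.mul_sum, ← Finset.mul_sum, ← Nat.cast_sum] at hsum
        change _ ≤ 64 * L.potential σ + B * (L.queried σ : ℝ) at hsum
        have hq' : (L.queried σ : ℝ) ≤ D := by exact_mod_cast hq.le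
        have hq'' : B * (L.queried σ : ℝ) ≤ B * D := by gcongr
        rw [div_mul_eq_mul_div, le_div_iff₀ (by positivity)]
        linarith)
    A (fun _ => none) (fun i hi => absurd rfl hi) (by rw [queried_none]; exact Nat.zero_le _) hA
  rw [queried_none, potential_none] at hroot
  have herr' : avg (fun x => ind (A.eval x ≠ L.func (k / 2) x)) ≤ ε := by
    rw [← prob_eq_avg]
    exact herr
  have e : (fun x => ind (assign A.eval (fun _ => none) x ≠
      assign (L.func (k / 2)) (fun _ => none) x)) = fun x => ind (A.eval x ≠ L.func (k / 2) x) := rfl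
  rw [e] at hroot
  have h1 : α * avg (fun x => ind (A.eval x ≠ L.func (k / 2) x)) ≤ α * ε := by gcongr
  have h2 : 128 / (Fintype.card β * k : ℝ) * D ≤ 64 / B := by
    rw [div_mul_eq_mul_div, div_le_div_iff₀ (by positivity) hB0]
    linarith
  simp only [Nat.sub_zero, Nat.cast_zero, zero_add, sub_zero] at hroot
  rw [← le_div_iff₀ (by positivity)]
  linarith

end alive

end Layout

/-! ### Upper bounds on tree size -/

section trees

variable {n : ℕ}

/-- A tree that queries all variables in `X` and continues with a tree of size at most `B`. -/
theorem exists_tree_of_piecewise (X : Finset (Fin n)) {B : ℕ} (g : (Fin n → Bool) → Bool)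
    (h : ∀ a : Fin n → Bool, ∃ T : DecisionTree n,
      (T.eval = fun x => g (X.piecewise a x)) ∧ T.size ≤ B) :
    ∃ T : DecisionTree n, T.eval = g ∧ T.size ≤ 2 ^ X.card * B := by
  induction X using Finset.induction_on generalizing g with
  | empty => simpa using h fun _ => false
  | insert i X hi ih =>
    have hb : ∀ b, ∃ T : DecisionTree n, T.eval = fix g i b ∧ T.size ≤ 2 ^ X.card * B := by
      refine fun b => ih (fix g i b) fun a => ?_
      obtain ⟨T, h1, h2⟩ := h (Function.update a i b)
      refine ⟨T, ?_, h2⟩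
      rw [h1]
      funext x
      unfold fix
      congr 1
      funext l
      by_cases hl : l = i
      · subst hl; simp [Finset.piecewise]
      · simp [Finset.piecewise, hl]
    obtain ⟨T₀, e₀, s₀⟩ := hb false
    obtain ⟨T₁, e₁, s₁⟩ := hb true
    refine ⟨.node i T₀ T₁, ?_, ?_⟩
    · funext x
      simp only [Tree.eval, e₀, e₁, fix]
      have := Function.update_eq_self i x
      split_ifs with hx
      · rw [hx] at this; rw [this]
      · rw [Bool.not_eq_true] at hx
        rw [hx] at this; rw [this]
    · rw [Finset.card_insert_of_notMem hi, pow_succ]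
      simp only [Tree.size]
      linarith

theorem exists_tree_of_dependsOn {Y : Finset (Fin n)} {g : (Fin n → Bool) → Bool}
    (h : DependsOn g (Y : Set (Fin n))) :
    ∃ T : DecisionTree n, T.eval = g ∧ T.size ≤ 2 ^ Y.card := by
  have := exists_tree_of_piecewise Y (B := 1) g fun a => ⟨.leaf (g a), ?_, le_rfl⟩
  · simpa using this
  · funext x
    refine h fun i hi => ?_
    simp [Finset.mem_coe.mp hi]

/-- The tree with its leftmost leaf replaced by a redundant query. -/
def Tree.pad {α : Type} (i : Fin n) : Tree n α → Tree n α
  | .leaf a => .node i (.leaf a) (.leaf a)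
  | .node j t₀ t₁ => .node j (t₀.pad i) t₁

theorem Tree.eval_pad {α : Type} (i : Fin n) (T : Tree n α) : (T.pad i).eval = T.eval := by
  induction T with
  | leaf a => funext x; simp [Tree.pad, Tree.eval]
  | node j t₀ t₁ h₀ _ => funext x; simp only [Tree.pad, Tree.eval, h₀]

theorem Tree.size_pad {α : Type} (i : Fin n) (T : Tree n α) : (T.pad i).size = T.size + 1 := by
  induction T with
  | leaf a => rfl
  | node j t₀ t₁ h₀ _ => simp only [Tree.pad, Tree.size, h₀]; ring

/-- Redundant queries turn an upper bound on size into the exact size `s`; a variable is needed to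
query. -/
theorem exists_tree_size_eq (hn : 0 < n) (T : DecisionTree n) {s : ℕ} (hs : T.size ≤ s) :
    ∃ T' : DecisionTree n, T'.eval = T.eval ∧ T'.size = s := by
  induction s, hs using Nat.le_induction with
  | base => exact ⟨T, rfl, rfl⟩
  | succ s _ ih =>
    obtain ⟨T', h1, h2⟩ := ih
    exact ⟨T'.pad ⟨0, hn⟩, by rw [Tree.eval_pad, h1], by rw [Tree.size_pad, h2]⟩

namespace Layout

variable {τ β : Type} [DecidableEq τ] [DecidableEq β] {L : Layout n τ β} [Fintype τ]

/-- After all tribes are read, the active colours are known: with none the function is constant,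
with two it is 1, and with exactly one it depends only on that block. -/
theorem exists_tree_func {w k : ℕ} (hw : ∀ t, (L.tribe t).card = w)
    (hk : ∀ j, (L.block j).card = k) (h : ℕ) :
    ∃ T : DecisionTree n, T.eval = L.func h ∧ T.size ≤ 2 ^ (Fintype.card τ * w + k) := by
  set X := Finset.univ.biUnion L.tribe with hX
  have hXc : X.card ≤ Fintype.card τ * w := by
    rw [hX, ← Finset.card_univ]
    exact Finset.card_biUnion_le_card_mul _ _ _ fun t _ => (hw t).le
  have hmem : ∀ t, ∀ i ∈ L.tribe t, i ∈ X := fun t i hi =>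
    Finset.mem_biUnion.mpr ⟨t, Finset.mem_univ t, hi⟩
  have hsat : ∀ a x t, L.Sat (X.piecewise a x) t ↔ L.Sat a t := fun a x t => by
    refine forall₂_congr fun i hi => ?_
    simp [hmem t i hi]
  have hact : ∀ a x j, L.Active (X.piecewise a x) j ↔ L.Active a j := fun a x j =>
    exists_congr fun t => and_congr_right fun _ => hsat a x t
  obtain ⟨T, h1, h2⟩ := exists_tree_of_piecewise X (B := 2 ^ k) (L.func h) fun a => by
    by_cases ha : ∃ j, L.Active a j
    · obtain ⟨j, hj⟩ := ha
      by_cases hu : ∀ j', L.Active a j' → j' = j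
      · rw [← hk j]
        refine exists_tree_of_dependsOn fun x y hxy => ?_
        refine func_congr (fun t => (hsat a x t).trans (hsat a y t).symm) fun j' hj' => ?_
        obtain rfl := hu j' ((hact a x j').mp hj')
        have : ((L.block j').filter fun i => X.piecewise a x i = true) =
            (L.block j').filter fun i => X.piecewise a y i = true := by
          refine Finset.filter_congr fun i hi => ?_
          rw [Finset.piecewise, Finset.piecewise, hxy i (Finset.mem_coe.mpr hi)]
        unfold Heavy
        rw [this]
      · push Not at hu
        obtain ⟨j', hj', hne⟩ := hu
        refine ⟨.leaf true, ?_, Nat.one_le_two_pow⟩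
        funext x
        symm
        rw [Tree.eval, func_eq_true]
        exact Or.inr (Or.inl ⟨j', j, hne, (hact a x j').mpr hj', (hact a x j).mpr hj⟩)
    · obtain ⟨T, h1, h2⟩ := exists_tree_of_dependsOn (Y := ∅)
        (g := fun x => L.func h (X.piecewise a x)) fun x y _ =>
          func_congr (fun t => (hsat a x t).trans (hsat a y t).symm) fun j hj =>
            absurd ⟨j, (hact a x j).mp hj⟩ ha
      exact ⟨T, h1, h2.trans (Nat.pow_le_pow_right two_pos (Nat.zero_le k))⟩
  refine ⟨T, h1, h2.trans ?_⟩
  rw [pow_add]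
  gcongr
  norm_num

end Layout

end trees

end TopDown

namespace TopDown

/-! ### Existence of layouts and choice of parameters -/

namespace Layout

theorem exists_layout {n : ℕ} {τ β : Type} [DecidableEq τ] [DecidableEq β] [Fintype τ] [Fintype β]
    (color : τ → Option β) {w k : ℕ} (h : Fintype.card τ * w + Fintype.card β * k ≤ n) :
    ∃ L : Layout n τ β, L.color = color ∧ (∀ t, (L.tribe t).card = w) ∧
      ∀ j, (L.block j).card = k := by
  have hcard : Fintype.card (τ × Fin w ⊕ β × Fin k) ≤ Fintype.card (Fin n) := by
    simpa using h
  obtain ⟨e⟩ := Function.Embedding.nonempty_of_card_le hcard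
  let p : τ × Fin w ⊕ β × Fin k → Option (τ ⊕ β) := fun a => some (a.map Prod.fst Prod.fst)
  refine ⟨⟨Function.extend e p fun _ => none, color⟩, rfl, fun t => ?_, fun j => ?_⟩
  · have : tribe (n := n) ⟨Function.extend e p fun _ => none, color⟩ t =
        Finset.univ.image fun l : Fin w => e (.inl (t, l)) := by
      ext i
      simp only [mem_tribe, Finset.mem_image, Finset.mem_univ, true_and]
      constructor
      · intro hi
        by_cases hex : ∃ a, e a = i
        · obtain ⟨a, rfl⟩ := hex
          rw [e.injective.extend_apply] at hi
          rcases a with ⟨t', l⟩ | ⟨j', l⟩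
          · simp only [p, Sum.map_inl, Option.some.injEq, Sum.inl.injEq] at hi
            exact ⟨l, by rw [hi]⟩
          · simp [p] at hi
        · rw [Function.extend_apply' _ _ _ hex] at hi
          simp at hi
      · rintro ⟨l, rfl⟩
        rw [e.injective.extend_apply]
        rfl
    rw [this, Finset.card_image_of_injective _ fun a b hab => by simpa using e.injective hab]
    simp
  · have : block (n := n) ⟨Function.extend e p fun _ => none, color⟩ j =
        Finset.univ.image fun l : Fin k => e (.inr (j, l)) := by
      ext i
      simp only [mem_block, Finset.mem_image, Finset.mem_univ, true_and]
      constructor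
      · intro hi
        by_cases hex : ∃ a, e a = i
        · obtain ⟨a, rfl⟩ := hex
          rw [e.injective.extend_apply] at hi
          rcases a with ⟨t', l⟩ | ⟨j', l⟩
          · simp [p] at hi
          · simp only [p, Sum.map_inr, Option.some.injEq, Sum.inr.injEq] at hi
            exact ⟨l, by rw [hi]⟩
        · rw [Function.extend_apply' _ _ _ hex] at hi
          simp at hi
      · rintro ⟨l, rfl⟩
        rw [e.injective.extend_apply]
        rfl
    rw [this, Finset.card_image_of_injective _ fun a b hab => by simpa using e.injective hab]
    simp

end Layout

/-- The number of tribes of width `log₂ Q` that makes the tribes function nearly balanced. -/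
theorem exists_balanced_pow {Q : ℕ} (hQ : 2 ≤ Q) :
    ∃ N ≤ Q, (1 - 1 / (Q : ℝ)) ^ N ≤ 1 / 2 ∧ 1 / 2 - 1 / (Q : ℝ) ≤ (1 - 1 / (Q : ℝ)) ^ N := by
  have hQ0 : (2 : ℝ) ≤ Q := by exact_mod_cast hQ
  have hu0 : (0 : ℝ) < 1 / (Q : ℝ) := by positivity
  have hu1 : 1 / (Q : ℝ) ≤ 1 / 2 := one_div_le_one_div_of_le two_pos hQ0
  have hex : (1 - 1 / (Q : ℝ)) ^ Q ≤ 1 / 2 := by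
    refine (one_sub_pow_le hu0.le (by linarith) Q).trans_eq ?_
    rw [mul_one_div_cancel (by positivity)]
    norm_num
  classical
  have hex' : ∃ N, (1 - 1 / (Q : ℝ)) ^ N ≤ 1 / 2 := ⟨Q, hex⟩
  refine ⟨Nat.find hex', Nat.find_min' hex' hex, Nat.find_spec hex', ?_⟩
  have hpos : Nat.find hex' ≠ 0 := by
    intro h
    have := Nat.find_spec hex'
    rw [h, pow_zero] at this
    norm_num at this
  -- For the least `N`, the previous power is still above 1/2, and one more factor loses at most
  -- `1/Q`.
  obtain ⟨N', hN'⟩ := Nat.exists_eq_succ_of_ne_zero hpos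
  have hmin := Nat.find_min hex' (m := N') (by omega)
  rw [not_le] at hmin
  rw [hN', pow_succ]
  calc (1 : ℝ) / 2 - 1 / Q ≤ 1 / 2 * (1 - 1 / Q) := by linarith
    _ ≤ _ := by
      refine mul_le_mul_of_nonneg_right hmin.le ?_
      linarith

theorem IsOutput.queriesMaxInfluence {n : ℕ} {G : ℝ → ℝ} (hG : IsImpurity G)
    {f : (Fin n → Bool) → Bool} (hf : Monotone f) {ε : ℝ} {A : DecisionTree n}
    (hA : IsOutput G f ε A) : QueriesMaxInfluence f A ∧ error A.eval f ≤ ε := by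
  obtain ⟨T, hT, happ, rfl⟩ := hA
  exact ⟨(hT.queriesMaxInfluence hG hf).1.completion, happ⟩

/-- The hard function at scale `v`, with a bound on the size of the outputs in terms of the
parameter `B`. -/
theorem exists_hard_function_aux {v B n : ℕ} (hv : 10 ≤ v) (hB : 4 ≤ B) (hn : 9 * 32 ^ v ≤ n)
    {α ε : ℝ} (hα : 2 ≤ α) (hαv : 1 ≤ α * (1 / 2 - 129 / 2 ^ v)) :
    ∃ T : DecisionTree n, T.size ≤ 2 ^ (9 * v * 16 ^ v) ∧ Monotone T.eval ∧
      ∀ G : ℝ → ℝ, IsImpurity G → ∀ A : DecisionTree n, IsOutput G T.eval ε A →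
        (1 - α * ε - 64 / B) * 2 ^ (32 ^ v / (2 * B)) ≤ A.size := by
  have h2v : 1024 ≤ 2 ^ v := (Nat.pow_le_pow_right two_pos hv : 2 ^ 10 ≤ 2 ^ v)
  have hvv : v < 2 ^ v := Nat.lt_two_pow_self
  set y := 2 ^ v with hy
  have e16 : 16 ^ v = y ^ 4 := by rw [hy, ← pow_mul, mul_comm, pow_mul]; norm_num
  have e32 : 32 ^ v = y ^ 5 := by rw [hy, ← pow_mul, mul_comm, pow_mul]; norm_num
  have hyR : ((2 : ℝ) ^ v) = (y : ℝ) := by rw [hy]; push_cast; rfl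
  have hy1 : (1024 : ℝ) ≤ y := by exact_mod_cast h2v
  have hy0 : (0 : ℝ) < y := by linarith
  have hu : (1 / 2 : ℝ) ^ (4 * v) = 1 / ((y ^ 4 : ℕ) : ℝ) := by
    rw [div_pow, one_pow, mul_comm, pow_mul, hyR]
    push_cast
    rfl
  obtain ⟨N, hNQ, hN1, hN2⟩ := exists_balanced_pow (Q := y ^ 4)
    (by calc 2 ≤ y := by omega
          _ ≤ y ^ 4 := Nat.le_self_pow (by norm_num) y)
  -- Large enough that block variables beat tribe variables, yet the `y * M` coloured tribes have
  -- total expected number of satisfied ones only `256 / y`.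
  set M := 256 * y ^ 2 with hMdef
  let color : Fin N ⊕ Fin y × Fin M → Option (Fin y) := Sum.elim (fun _ => none) fun a => some a.1
  have hτ : Fintype.card (Fin N ⊕ Fin y × Fin M) = N + y * M := by simp
  have hτle : N + y * M ≤ 2 * y ^ 4 := by
    have : y * M ≤ y ^ 4 := by
      calc y * M = 256 * y ^ 3 := by rw [hMdef]; ring
        _ ≤ y * y ^ 3 := by gcongr; omega
        _ = y ^ 4 := by ring
    omega
  have hvars : Fintype.card (Fin N ⊕ Fin y × Fin M) * (4 * v) + Fintype.card (Fin y) * y ^ 4 ≤ n := by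
    rw [hτ, Fintype.card_fin]
    refine le_trans ?_ hn
    rw [e32]
    calc (N + y * M) * (4 * v) + y * y ^ 4 ≤ (2 * y ^ 4) * (4 * y) + y * y ^ 4 := by gcongr
      _ = 9 * y ^ 5 := by ring
  obtain ⟨L, hcol, hw, hk⟩ := Layout.exists_layout color hvars
  have hM : ∀ j, (Finset.univ.filter fun t => L.color t = some j).card = M := by
    intro j
    have : (Finset.univ.filter fun t => L.color t = some j) =
        Finset.univ.image fun l : Fin M => (Sum.inr (j, l) : Fin N ⊕ Fin y × Fin M) := by
      ext t
      rw [hcol]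
      rcases t with t | ⟨j', l⟩ <;> simp [color, eq_comm]
    rw [this, Finset.card_image_of_injective _ fun a b hab => by simpa using hab]
    simp
  have hN : (Finset.univ.filter fun t => L.color t = none).card = N := by
    have : (Finset.univ.filter fun t => L.color t = none) =
        Finset.univ.image fun l : Fin N => (Sum.inl l : Fin N ⊕ Fin y × Fin M) := by
      ext t
      rw [hcol]
      rcases t with t | ⟨j', l⟩ <;> simp [color]
    rw [this, Finset.card_image_of_injective _ fun a b hab => by simpa using hab]
    simp
  set u : ℝ := 1 / ((y ^ 4 : ℕ) : ℝ) with hudef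
  have hu' : u = 1 / (y : ℝ) ^ 4 := by rw [hudef]; push_cast; rfl
  have hu0 : 0 < u := by rw [hu']; positivity
  have huly : u ≤ 1 / y := by
    rw [hu']
    exact one_div_le_one_div_of_le hy0 (le_self_pow₀ (by linarith) (by norm_num))
  have hy1' : 1 / (y : ℝ) ≤ 1 / 1024 := one_div_le_one_div_of_le (by norm_num) hy1
  have hMu : (M : ℝ) * u = 256 / y ^ 2 := by
    rw [hMdef, hu']; push_cast; field_simp
  have hMu1 : (M : ℝ) * u ≤ 1 := by
    rw [hMu, div_le_one (by positivity)]
    nlinarith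
  -- The uncoloured tribes contribute `1/2 - u` with `u ≤ 1/y`, and the coloured ones lose at most
  -- `256/y` of that half.
  have hall : 1 / 2 - 129 / (y : ℝ) ≤ (1 - u) ^ (N + y * M) := by
    have h1 : 1 - 256 / (y : ℝ) ≤ (1 - u) ^ (y * M) := by
      have := one_add_mul_le_pow (a := -u) (by linarith) (y * M)
      rw [← sub_eq_add_neg] at this
      refine le_trans (le_of_eq ?_) this
      rw [hMdef, hu']; push_cast; field_simp; ring
    have h256 : 256 / (y : ℝ) = 256 * (1 / y) := by ring
    have h129 : 129 / (y : ℝ) = 129 * (1 / y) := by ring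
    have hiy : 0 < 1 / (y : ℝ) := by positivity
    rw [pow_add]
    calc 1 / 2 - 129 / (y : ℝ) ≤ (1 / 2 - u) * (1 - 256 / y) := by
          rw [h256, h129]
          nlinarith [mul_pos hu0 hiy]
      _ ≤ (1 - u) ^ N * (1 - 256 / y) := by
          refine mul_le_mul_of_nonneg_right hN2 ?_
          rw [h256]; linarith
      _ ≤ _ := by
          refine mul_le_mul_of_nonneg_left h1 (pow_nonneg (by linarith) _)
  have h129' : 129 / (y : ℝ) ≤ 1 / 4 := by
    rw [div_le_iff₀ hy0]; linarith
  obtain ⟨T, hT1, hT2⟩ := L.exists_tree_func hw hk (y ^ 4 / 2)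
  refine ⟨T, hT2.trans (Nat.pow_le_pow_right two_pos ?_), hT1 ▸ L.monotone_func _, ?_⟩
  · rw [hτ, e16]
    calc (N + y * M) * (4 * v) + y ^ 4 ≤ (2 * y ^ 4) * (4 * v) + v * y ^ 4 := by
          gcongr
          exact Nat.le_mul_of_pos_left _ (by omega)
      _ = 9 * v * y ^ 4 := by ring
  · intro G hG A hA
    rw [hT1] at hA
    obtain ⟨hA1, hA2⟩ := hA.queriesMaxInfluence hG (L.monotone_func _)
    rw [e32]
    refine Layout.size_ge_of_queriesMaxInfluence (K := y ^ 2) hw hk hM hN ?_ ?_ ?_ hB ?_ ?_ ?_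
      (by linarith) ?_ ?_ hA1 hA2
    · exact dvd_pow (dvd_pow_self 2 (by omega)) (by norm_num)
    · calc 64 ≤ y := by omega
        _ ≤ y ^ 4 := Nat.le_self_pow (by norm_num) y
    · have : (y ^ 2) ^ 2 = y ^ 4 := by ring
      omega
    · rw [hu, hτ]
      have h1 : (M : ℝ) * u / 2 ≤ 1 - (1 - u) ^ M := by
        have hp := one_sub_pow_le hu0.le (by linarith) M
        have h0 : 0 ≤ (M : ℝ) * u := by positivity
        have : 1 / (1 + M * u) ≤ 1 - M * u / 2 := by
          rw [div_le_iff₀ (by linarith)]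
          nlinarith
        linarith
      -- The three factors bound below: no tribe satisfied by 1/4, some tribe of the colour
      -- satisfied by `M u / 2`, the block tied by `1/(4 y^2)`. Their product is `8u` since `M = 256
      -- y^2`.
      calc 2 * u < 8 * u := by linarith
        _ = 1 / 4 * (M * u / 2) * (1 / (4 * ((y ^ 2 : ℕ) : ℝ))) := by
            rw [hMdef]; push_cast; field_simp; norm_num
        _ ≤ _ := by
            have h0 : 0 ≤ (M : ℝ) * u := by positivity
            gcongr
            all_goals linarith
    · rw [Fintype.card_fin]
      calc 2 * B * (y ^ 5 / (2 * B)) ≤ y ^ 5 := Nat.mul_div_le _ _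
        _ = y * y ^ 4 := by ring
    · rw [Fintype.card_fin]; omega
    · rw [hu]
      nlinarith
    · rw [hu, hτ]
      rw [hyR] at hαv
      refine hαv.trans (mul_le_mul_of_nonneg_left hall (by linarith))

theorem exists_hard_function {ε : ℝ} (hε₀ : 0 < ε) (hε₁ : ε < 1 / 2) :
    ∃ η : ℝ, 0 < η ∧ ∃ v₀ : ℕ, ∀ v ≥ v₀, ∀ n ≥ 9 * 32 ^ v,
      ∃ T : DecisionTree n, T.size ≤ 2 ^ (9 * v * 16 ^ v) ∧ Monotone T.eval ∧
        ∀ G : ℝ → ℝ, IsImpurity G → ∀ A : DecisionTree n, IsOutput G T.eval ε A →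
          (2 : ℝ) ^ (η * 32 ^ v) ≤ A.size := by
  set γ := 1 / 2 - ε with hγ
  have hγ0 : 0 < γ := by linarith
  obtain ⟨B₀, hB₀⟩ := exists_nat_ge (128 / γ)
  set B := max B₀ 4 with hBdef
  have hB4 : 4 ≤ B := le_max_right _ _
  have hB : 128 / γ ≤ B := hB₀.trans (by exact_mod_cast le_max_left _ _)
  have hB0 : (0 : ℝ) < B := by exact_mod_cast (by omega : 0 < B)
  obtain ⟨v₁, hv₁⟩ := exists_nat_ge (258 / γ)
  obtain ⟨v₂, hv₂⟩ := exists_nat_ge (4 * B * (1 - Real.logb 2 (γ / 2)))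
  refine ⟨1 / (4 * B), by positivity, max 10 (max v₁ v₂), fun v hv n hn => ?_⟩
  have hv10 : 10 ≤ v := le_trans (le_max_left _ _) hv
  have hv1 : v₁ ≤ v := le_trans ((le_max_left _ _).trans (le_max_right _ _)) hv
  have hv2 : v₂ ≤ v := le_trans ((le_max_right _ _).trans (le_max_right _ _)) hv
  have hv2y : (v : ℝ) ≤ 2 ^ v := by exact_mod_cast (Nat.lt_two_pow_self (n := v)).le
  have hv32 : (v : ℝ) ≤ 32 ^ v := hv2y.trans (by gcongr; norm_num)
  have hpos : 0 < ε + γ / 2 := by linarith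
  have hδ : 129 / (2 : ℝ) ^ v ≤ γ / 2 := by
    rw [div_le_iff₀ (by positivity)]
    have h1 : 258 / γ ≤ 2 ^ v := hv₁.trans (le_trans (by exact_mod_cast hv1) hv2y)
    rw [div_le_iff₀ hγ0] at h1
    linarith
  -- Here `ε + γ/2 = 1/2 - γ/2` lies strictly between `ε` and 1/2: large `v` brings the guaranteed
  -- error at a leaf above it, while `α ε ≤ 1 - γ` still leaves room.
  obtain ⟨T, h1, h2, h3⟩ := exists_hard_function_aux (ε := ε) (α := 1 / (ε + γ / 2)) hv10 hB4 hn
    (by rw [le_div_iff₀ hpos]; linarith)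
    (by rw [div_mul_eq_mul_div, le_div_iff₀ hpos]; linarith)
  refine ⟨T, h1, h2, fun G hG A hA => le_trans ?_ (h3 G hG A hA)⟩
  have hc : γ / 2 ≤ 1 - 1 / (ε + γ / 2) * ε - 64 / B := by
    have e1 : 64 / (B : ℝ) ≤ γ / 2 := by
      rw [div_le_iff₀ hB0]
      rw [div_le_iff₀ hγ0] at hB
      linarith
    have e2 : 1 / (ε + γ / 2) * ε ≤ 1 - γ := by
      rw [div_mul_eq_mul_div, div_le_iff₀ hpos]
      nlinarith
    linarith
  have hD : (32 : ℝ) ^ v / (2 * B) - 1 ≤ ((32 ^ v / (2 * B) : ℕ) : ℝ) := by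
    have := (Nat.lt_div_mul_add (a := 32 ^ v) (b := 2 * B) (by omega)).le
    have h' : (32 : ℝ) ^ v ≤ ((32 ^ v / (2 * B) : ℕ) : ℝ) * (2 * B) + 2 * B := by exact_mod_cast this
    rw [sub_le_iff_le_add, div_le_iff₀ (by positivity)]
    linarith
  -- Halving the exponent pays for the constant factor `γ/2` and for the rounding in `32 ^ v / (2 *
  -- B)` once `v` is large.
  calc (2 : ℝ) ^ (1 / (4 * B : ℝ) * 32 ^ v)
      ≤ 2 ^ (Real.logb 2 (γ / 2) + ((32 ^ v / (2 * B) : ℕ) : ℝ)) := by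
        refine Real.rpow_le_rpow_of_exponent_le one_le_two ?_
        have h4 : 4 * B * (1 - Real.logb 2 (γ / 2)) ≤ 32 ^ v :=
          hv₂.trans (le_trans (by exact_mod_cast hv2) hv32)
        have h5 : 1 - Real.logb 2 (γ / 2) ≤ 32 ^ v / (4 * B) := by
          rw [le_div_iff₀ (by positivity)]; linarith
        have h6 : (32 : ℝ) ^ v / (2 * B) = 2 * (32 ^ v / (4 * B)) := by
          field_simp; norm_num
        have h7 : 1 / (4 * B : ℝ) * 32 ^ v = 32 ^ v / (4 * B) := by ring
        linarith
    _ = γ / 2 * 2 ^ (32 ^ v / (2 * B)) := by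
        rw [Real.rpow_add two_pos, Real.rpow_logb two_pos (by norm_num) (by positivity),
          Real.rpow_natCast]
    _ ≤ _ := by gcongr

/-! ### From the scales `v` to all `n` and `s` -/

/-- Serves bounded `s`: a single leaf errs with probability 1/2 on a dictator, so any output has at
least two leaves. -/
theorem exists_dictator {n : ℕ} (hn : 0 < n) {ε : ℝ} (hε : ε < 1 / 2) :
    ∃ T : DecisionTree n, T.size = 2 ∧ Monotone T.eval ∧
      ∀ (G : ℝ → ℝ) (A : DecisionTree n), IsOutput G T.eval ε A → 2 ≤ A.size := by
  set i : Fin n := ⟨0, hn⟩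
  refine ⟨.node i (.leaf false) (.leaf true), rfl, ?_, ?_⟩
  · intro x y h
    have := h i
    simp only [Tree.eval]
    cases hx : x i <;> cases hy : y i <;> simp_all
  · rintro G A ⟨T, -, happ, rfl⟩
    unfold Approximates at happ
    generalize completion _ T = A at happ
    cases A with
    | node j t₀ t₁ => exact Nat.add_le_add t₀.one_le_size t₁.one_le_size
    | leaf b =>
      unfold error at happ
      rw [prob_eq_avg, avg_cond i] at happ
      simp only [Tree.eval, Function.update_self, Bool.false_eq_true, if_true, if_false,
        avg_const] at happ
      cases b <;> simp [ind] at happ <;> linarith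

/-- A scale `v` at which `v ^ k * 16 ^ v` is comparable to `m`. -/
theorem exists_scale (k v₁ : ℕ) {m : ℝ} (hm : (v₁ : ℝ) ^ k * 16 ^ v₁ ≤ m) :
    ∃ v ≥ v₁, (v : ℝ) ^ k * 16 ^ v ≤ m ∧ m < ((v + 1 : ℕ) : ℝ) ^ k * 16 ^ (v + 1) := by
  by_contra! hcon
  have hall : ∀ v ≥ v₁, (v : ℝ) ^ k * 16 ^ v ≤ m := by
    intro v hv
    induction v, hv using Nat.le_induction with
    | base => exact hm
    | succ v hv ih => exact hcon v hv ih
  obtain ⟨v, hv⟩ := exists_nat_gt m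
  have h := hall (max v₁ (v + 1)) (le_max_left _ _)
  set l := max v₁ (v + 1)
  have hl : v + 1 ≤ l := le_max_right _ _
  have h1 : (1 : ℝ) ≤ (l : ℝ) ^ k := one_le_pow₀ (by exact_mod_cast (by omega : 1 ≤ l))
  have h2 : (l : ℝ) ≤ 16 ^ l := by exact_mod_cast (Nat.lt_pow_self (by norm_num)).le
  have h3 : (v : ℝ) ≤ l := by exact_mod_cast (by omega : v ≤ l)
  have h4 : (16 : ℝ) ^ l ≤ (l : ℝ) ^ k * 16 ^ l := le_mul_of_one_le_left (by positivity) h1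
  linarith

/-- There are enough variables for the hard function at scale `v`. -/
theorem le_of_logb_le {C m : ℝ} {a v n : ℕ} (hv : 2 ≤ v) (hC : 6561 * (|C| * 8 ^ a) ≤ v)
    (hm : (v : ℝ) ^ (a + 2) * 16 ^ v ≤ m)
    (hmn : m ≤ C * (n : ℝ) ^ (4 / 5 : ℝ) * Real.log (n + 2) ^ a) : 9 * 32 ^ v ≤ n := by
  by_contra! hlt
  have hv0 : (2 : ℝ) ≤ v := by exact_mod_cast hv
  have hnR : (n : ℝ) + 2 ≤ 10 * 32 ^ v := by
    have h1 : (n : ℝ) ≤ 9 * 32 ^ v := by exact_mod_cast hlt.le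
    have h2 : (2 : ℝ) ≤ 32 ^ v := by
      calc (2 : ℝ) ≤ 32 ^ 1 := by norm_num
        _ ≤ 32 ^ v := pow_le_pow_right₀ (by norm_num) (by omega)
    linarith
  -- `32^v = (2^v)^5`, so the power 4/5 gives `16^v`; the constant is `9^4`, from rounding 9 up to
  -- `9^5`.
  have hpow : (n : ℝ) ^ (4 / 5 : ℝ) ≤ 6561 * 16 ^ v := by
    have h1 : (n : ℝ) ≤ (9 * 2 ^ v) ^ 5 := by
      have h32 : ((2 : ℝ) ^ v) ^ 5 = 32 ^ v := by rw [← pow_mul, mul_comm, pow_mul]; norm_num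
      have : (0 : ℝ) < 32 ^ v := by positivity
      rw [mul_pow, h32]
      have h2 : (n : ℝ) ≤ 9 * 32 ^ v := by exact_mod_cast hlt.le
      norm_num
      linarith
    calc (n : ℝ) ^ (4 / 5 : ℝ) ≤ (((9 * 2 ^ v) ^ 5 : ℝ)) ^ (4 / 5 : ℝ) :=
          Real.rpow_le_rpow (by positivity) h1 (by norm_num)
      _ = (9 * 2 ^ v) ^ 4 := by
          rw [← Real.rpow_natCast, ← Real.rpow_mul (by positivity), ← Real.rpow_natCast]
          norm_num
      _ = 6561 * 16 ^ v := by
          rw [mul_pow, ← pow_mul, mul_comm v, pow_mul]; norm_num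
  have hlog : Real.log (n + 2) ≤ 8 * v := by
    have h10 : (10 : ℝ) * 32 ^ v ≤ 2 ^ (8 * v) := by
      calc (10 : ℝ) * 32 ^ v ≤ 8 ^ v * 32 ^ v := by
            gcongr
            calc (10 : ℝ) ≤ 8 ^ 2 := by norm_num
              _ ≤ 8 ^ v := pow_le_pow_right₀ (by norm_num) hv
        _ = 2 ^ (8 * v) := by rw [← mul_pow, pow_mul]; norm_num
    calc Real.log (n + 2) ≤ Real.log (2 ^ (8 * v)) :=
          Real.log_le_log (by positivity) (hnR.trans h10)
      _ = (8 * v) * Real.log 2 := by rw [Real.log_pow]; push_cast; ring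
      _ ≤ (8 * v) * 1 := by
          gcongr
          linarith [Real.log_two_lt_d9]
      _ = 8 * v := mul_one _
  have hlog0 : 0 ≤ Real.log ((n : ℝ) + 2) :=
    Real.log_nonneg (by linarith [Nat.cast_nonneg (α := ℝ) n])
  have hup : m ≤ |C| * (6561 * 16 ^ v) * (8 * v) ^ a := by
    refine hmn.trans ?_
    gcongr
    exact le_abs_self C
  have hva : (0 : ℝ) < (v : ℝ) ^ a * 16 ^ v := by positivity
  -- The factor `v^a` absorbs the logarithm of `n`; what remains is `v^2 ≤ 6561 |C| 8^a ≤ v`,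
  -- impossible for `v ≥ 2`.
  have h1 : (v : ℝ) ^ (a + 2) * 16 ^ v = v ^ 2 * (v ^ a * 16 ^ v) := by ring
  have h2 : |C| * (6561 * 16 ^ v) * (8 * v) ^ a = 6561 * (|C| * 8 ^ a) * (v ^ a * 16 ^ v) := by
    rw [mul_pow]; ring
  rw [h1] at hm
  rw [h2] at hup
  have h3 := le_of_mul_le_mul_right (hm.trans hup) hva
  nlinarith

/-- The exponent in the lower bound at scale `v`. -/
theorem mul_rpow_div_log_le {m : ℝ} {k v : ℕ} (hv : 1 ≤ v) (hm : (v : ℝ) ^ k * 16 ^ v ≤ m)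
    (hm' : m < ((v + 1 : ℕ) : ℝ) ^ k * 16 ^ (v + 1)) :
    m * m ^ (1 / 4 : ℝ) / Real.log (m + 2) ^ (2 * k) ≤ 32 * 32 ^ v := by
  have hv1 : (1 : ℝ) ≤ v := by exact_mod_cast hv
  have h16 : (16 : ℝ) ^ v ≤ m := by
    refine le_trans ?_ hm
    exact le_mul_of_one_le_left (by positivity) (one_le_pow₀ hv1)
  have hm0 : 0 ≤ m := le_trans (by positivity) h16
  have hlog : ((v + 1 : ℕ) : ℝ) ≤ Real.log (m + 2) := by
    calc ((v + 1 : ℕ) : ℝ) ≤ (4 * v : ℕ) * Real.log 2 := by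
          push_cast
          nlinarith [Real.log_two_gt_d9]
      _ = Real.log (16 ^ v) := by
          rw [← Real.log_pow, pow_mul]; norm_num
      _ ≤ Real.log (m + 2) := Real.log_le_log (by positivity) (by linarith)
  set z : ℝ := ((v + 1 : ℕ) : ℝ) with hz
  have hz1 : 1 ≤ z := by rw [hz]; push_cast; linarith
  have hzk : 1 ≤ z ^ k := one_le_pow₀ hz1
  -- Both `m` and its fourth root cost a factor `z^k`, where `z = v + 1 ≤ log (m + 2)`; this is why
  -- the logarithm carries the power `2k`.
  have hroot : m ^ (1 / 4 : ℝ) ≤ z ^ k * 2 ^ (v + 1) := by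
    have h4 : m ≤ (z ^ k * 2 ^ (v + 1)) ^ 4 := by
      have e : ((2 : ℝ) ^ (v + 1)) ^ 4 = 16 ^ (v + 1) := by
        rw [← pow_mul, mul_comm, pow_mul]; norm_num
      rw [mul_pow, e]
      refine hm'.le.trans ?_
      gcongr
      exact le_self_pow₀ hzk (by norm_num)
    calc m ^ (1 / 4 : ℝ) ≤ ((z ^ k * 2 ^ (v + 1)) ^ 4) ^ (1 / 4 : ℝ) :=
          Real.rpow_le_rpow hm0 h4 (by norm_num)
      _ = z ^ k * 2 ^ (v + 1) := by
          rw [← Real.rpow_natCast, ← Real.rpow_mul (by positivity)]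
          norm_num
  rw [div_le_iff₀ (pow_pos (by linarith) _)]
  calc m * m ^ (1 / 4 : ℝ) ≤ (z ^ k * 16 ^ (v + 1)) * (z ^ k * 2 ^ (v + 1)) := by gcongr
    _ = 16 ^ (v + 1) * 2 ^ (v + 1) * z ^ (2 * k) := by ring
    _ = 32 * 32 ^ v * z ^ (2 * k) := by
        rw [← mul_pow, pow_succ]; norm_num; left; ring
    _ ≤ _ := by gcongr

end TopDown

theorem theorem5 (ε : ℝ) (hε₀ : 0 < ε) (hε₁ : ε < 1 / 2) (C : ℝ) (a : ℕ) :
    ∃ c : ℝ, 0 < c ∧ ∃ b : ℕ, ∀ n s : ℕ, 1 ≤ s →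
      (s : ℝ) ≤ 2 ^ (C * (n : ℝ) ^ (4 / 5 : ℝ) * Real.log (n + 2) ^ a) →
      ∃ f : TopDown.DecisionTree n, f.size = s ∧ Monotone f.eval ∧
        ∀ G : ℝ → ℝ, TopDown.IsImpurity G →
          ∀ A : TopDown.DecisionTree n, TopDown.IsOutput G f.eval ε A →
            (s : ℝ) ^ (c * Real.logb 2 s ^ (1 / 4 : ℝ) / Real.log (Real.logb 2 s + 2) ^ b)
              ≤ (A.size : ℝ) := by
  obtain ⟨η, hη, v₀, hard⟩ := TopDown.exists_hard_function hε₀ hε₁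
  obtain ⟨v₂, hv₂⟩ := exists_nat_ge (6561 * (|C| * 8 ^ a))
  set v₁ := max 9 (max v₀ v₂) with hv₁
  have hv₁9 : 9 ≤ v₁ := le_max_left _ _
  have hv₁0 : v₀ ≤ v₁ := (le_max_left _ _).trans (le_max_right _ _)
  have hv₁2 : v₂ ≤ v₁ := (le_max_right _ _).trans (le_max_right _ _)
  set m₀ : ℝ := (v₁ : ℝ) ^ (a + 2) * 16 ^ v₁ with hm₀
  have hm₀1 : 1 ≤ m₀ := one_le_mul_of_one_le_of_one_le
    (one_le_pow₀ (by exact_mod_cast (by omega : 1 ≤ v₁))) (one_le_pow₀ (by norm_num))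
  -- The first bound on `c` serves the hard function. The second makes the exponent of 2 at most 1
  -- for `m < m₀`, where only the bound 2 is available. The power `2(a+2)` of the logarithm comes
  -- from the scale `v^(a+2) 16^v`.
  refine ⟨min (η / 32) (1 / m₀ ^ 2), by positivity, 2 * (a + 2), fun n s hs hsn => ?_⟩
  set c := min (η / 32) (1 / m₀ ^ 2) with hc
  have hc0 : 0 < c := by positivity
  have hsR : (1 : ℝ) ≤ s := by exact_mod_cast hs
  set m := Real.logb 2 s with hm
  have hsm : (2 : ℝ) ^ m = s := Real.rpow_logb two_pos (by norm_num) (by linarith)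
  have hmn : m ≤ C * (n : ℝ) ^ (4 / 5 : ℝ) * Real.log (n + 2) ^ a := by
    rw [← hsm] at hsn
    exact (Real.rpow_le_rpow_left_iff one_lt_two).mp hsn
  have hexp : (s : ℝ) ^ (c * m ^ (1 / 4 : ℝ) / Real.log (m + 2) ^ (2 * (a + 2))) =
      2 ^ (c * (m * m ^ (1 / 4 : ℝ) / Real.log (m + 2) ^ (2 * (a + 2)))) := by
    rw [← hsm, ← Real.rpow_mul two_pos.le]
    congr 1
    ring
  rcases hs.eq_or_lt with rfl | hs2
  · refine ⟨.leaf true, rfl, fun _ _ _ => le_rfl, fun G _ A _ => ?_⟩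
    rw [Nat.cast_one, Real.one_rpow]
    exact_mod_cast A.one_le_size
  have hm1 : 1 ≤ m := by
    rw [hm, Real.le_logb_iff_rpow_le one_lt_two (by linarith), Real.rpow_one]
    exact_mod_cast hs2
  have hn : 0 < n := by
    rcases Nat.eq_zero_or_pos n with rfl | h
    · rw [Nat.cast_zero, Real.zero_rpow (by norm_num)] at hmn
      linarith
    · exact h
  rcases lt_or_ge m m₀ with hsmall | hlarge
  · obtain ⟨T, hT, hmono, hout⟩ := TopDown.exists_dictator hn hε₁
    obtain ⟨T', hT', hs'⟩ := TopDown.exists_tree_size_eq hn T (s := s) (by omega)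
    refine ⟨T', hs', hT' ▸ hmono, fun G _ A hA => ?_⟩
    rw [hT'] at hA
    have h2 : (2 : ℝ) ≤ A.size := by exact_mod_cast hout G A hA
    refine le_trans ?_ h2
    rw [hexp]
    conv_rhs => rw [← Real.rpow_one 2]
    refine Real.rpow_le_rpow_of_exponent_le one_le_two ?_
    have hlog : 1 ≤ Real.log (m + 2) := by
      rw [Real.le_log_iff_exp_le (by linarith)]
      linarith [Real.exp_one_lt_d9]
    have hroot : m ^ (1 / 4 : ℝ) ≤ m₀ := by
      refine le_trans ?_ hsmall.le
      exact Real.rpow_le_self_of_one_le hm1 (by norm_num)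
    calc c * (m * m ^ (1 / 4 : ℝ) / Real.log (m + 2) ^ (2 * (a + 2)))
        ≤ c * (m * m ^ (1 / 4 : ℝ)) := by
          gcongr
          exact div_le_self (by positivity) (one_le_pow₀ hlog)
      _ ≤ 1 / m₀ ^ 2 * (m₀ * m₀) := by
          gcongr
          exact min_le_right _ _
      _ = 1 := by field_simp
  · obtain ⟨v, hv, hvm, hvm'⟩ := TopDown.exists_scale (a + 2) v₁ hlarge
    have hnv : 9 * 32 ^ v ≤ n := TopDown.le_of_logb_le (by omega)
      (hv₂.trans (by exact_mod_cast hv₁2.trans hv)) hvm hmn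
    obtain ⟨T, hT, hmono, hout⟩ := hard v (hv₁0.trans hv) n hnv
    -- Two of the factors `v` in the scale cover `9v`, as `v ≥ 9`; the remaining `v^a` is there for
    -- the logarithm of `n`.
    have hTs : T.size ≤ s := by
      have hv9 : (9 : ℝ) ≤ v := by exact_mod_cast hv₁9.trans hv
      have h1 : ((9 * v * 16 ^ v : ℕ) : ℝ) ≤ m := by
        refine le_trans ?_ hvm
        push_cast
        gcongr
        calc (9 : ℝ) * v ≤ v ^ 2 := by nlinarith
          _ ≤ v ^ (a + 2) := pow_le_pow_right₀ (by linarith) (by omega)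
      have h2 : (2 : ℝ) ^ (9 * v * 16 ^ v) ≤ s := by
        rw [← hsm, ← Real.rpow_natCast]
        exact Real.rpow_le_rpow_of_exponent_le one_le_two h1
      exact hT.trans (by exact_mod_cast h2)
    obtain ⟨T', hT', hs'⟩ := TopDown.exists_tree_size_eq hn T hTs
    refine ⟨T', hs', hT' ▸ hmono, fun G hG A hA => ?_⟩
    rw [hT'] at hA
    refine le_trans ?_ (hout G hG A hA)
    rw [hexp]
    refine Real.rpow_le_rpow_of_exponent_le one_le_two ?_
    calc c * (m * m ^ (1 / 4 : ℝ) / Real.log (m + 2) ^ (2 * (a + 2)))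
        ≤ η / 32 * (32 * 32 ^ v) := by
          refine mul_le_mul (min_le_left _ _) ?_ ?_ (by positivity)
          · exact TopDown.mul_rpow_div_log_le (by omega) hvm hvm'
          · have : 0 ≤ Real.log (m + 2) := Real.log_nonneg (by linarith)
            positivity
      _ = η * 32 ^ v := by ring
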